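/- Let $n\ge 5$. For a connected simple graph $G$ on $n$ vertices, let $D(G)$ be its distance matrix, let $Tr(G)$ be the diagonal matrix whose entry at a vertex $u$ is the sum of the distances from $u$ to all other vertices, and let $\rho_L(G)$ be the largest eigenvalue of the distance Laplacian matrix $L_D(G)=Tr(G)-D(G)$. A pendant vertex is a vertex of degree $1$. Let $T(n,3;1,2)$ be the tree on $n$ vertices obtained from a path $P_{n-3}$ on $n-3$ vertices by attaching one pendant edge at one end vertex of the path and two pendant edges at the other end vertex. If $G$ attains the maximum of $\rho_L$ among all connected graphs of order $n$ with exactly $3$ pendant vertices, then $G\cong T(n,3;1,2)$. -/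

import Mathlib

namespace SimpleGraph

section DistanceLaplacian

variable {V : Type*} [Fintype V]

/-- The distance matrix of a graph, with real entries. -/
noncomputable def distanceMatrix (G : SimpleGraph V) : Matrix V V ℝ :=
  Matrix.of fun u v => (G.dist u v : ℝ)

/-- The transmission of a vertex: the sum of its distances to all other vertices. -/
noncomputable def transmission (G : SimpleGraph V) (u : V) : ℝ :=
  ∑ v : V, (G.dist u v : ℝ)

/-- The distance Laplacian matrix: the diagonal matrix of transmissions minus the distance
matrix. -/
noncomputable def distanceLaplacian [DecidableEq V] (G : SimpleGraph V) : Matrix V V ℝ :=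
  Matrix.diagonal G.transmission - G.distanceMatrix

/-- The distance Laplacian spectral radius: the largest eigenvalue of the (real symmetric)
distance Laplacian matrix. For nonempty `V` its real spectrum is finite and nonempty, so that the
supremum is a maximum. -/
noncomputable def distanceLaplacianSpectralRadius [DecidableEq V] (G : SimpleGraph V) : ℝ :=
  sSup (spectrum ℝ G.distanceLaplacian)

end DistanceLaplacian

/-- A pendant vertex is a vertex of degree one, that is, with exactly one neighbour. -/
def IsPendantVertex {V : Type*} (G : SimpleGraph V) (v : V) : Prop :=
  (G.neighborSet v).ncard = 1

/-- The connected graphs on the vertex set `V` with exactly `k` pendant vertices. -/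
def connectedWithPendant (V : Type*) (k : ℕ) : Set (SimpleGraph V) :=
  {G | G.Connected ∧ {v | G.IsPendantVertex v}.ncard = k}

/-- The graph `T(n, k; t₁, t₂)`, where `t₁ + t₂ = k` and `k + 2 ≤ n`: it consists of a path on the
`n - k` vertices `Sum.inl 0, …, Sum.inl (n - k - 1)`, with `t₁` pendant edges attached at the first
path vertex and `t₂` pendant edges attached at the last one. -/
def pathWithPendants (n k t₁ t₂ : ℕ) : SimpleGraph (Fin (n - k) ⊕ (Fin t₁ ⊕ Fin t₂)) :=
  SimpleGraph.fromRel fun x y =>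
    match x, y with
    | .inl i, .inl j => i.val + 1 = j.val
    | .inl i, .inr (.inl _) => i.val = 0
    | .inl i, .inr (.inr _) => i.val + 1 = n - k
    | _, _ => False

end SimpleGraph

/-! The extremal tree is a broom: a path with one extra leaf next to one end, so that two twin
leaves share a neighbour. The proof compares all competitors with brooms on the same vertex set,
through the identity `xᵀ L_D(G) x = ½ ∑ d(u,v) (x u - x v)²`, whose right side is linear and
monotone in `d`.

Domination (`SimpleGraph.dist_mem_broomDominated`): if a connected graph has a vertex with three
neighbours, its distance function lies entrywise below a convex combination of metrics of labelled
brooms. Exactly three pendant vertices force such a vertex, since a connected graph of maximum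
degree at most 2 has too few leaves.

Comparison: let `x` be an eigenvector of the extremal `G` for its largest eigenvalue `ρ`. Each broom
is itself a competitor, so its form at `x` is at most `ρ (x ⬝ᵥ x)`, while the form of `G` equals
this and lies below the convex combination. Hence equality holds throughout, and `x` is a top
eigenvector of every broom that occurs with nonzero weight.

Rigidity (`IsTopBroomVector.eq_iff`): a top eigenvector of a broom agrees on the twins and is
otherwise injective, being strictly monotone along the path. So `x` determines the broom up to
swapping twins, the combination is a single broom metric, and `G` has the same distances except
possibly between the twins. If the twins were adjacent, `G` would have at most one pendant vertex;
so `G` is the broom. -/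

/-! ### The broom metric on natural labels -/

/-- The distance between the vertices labelled `i` and `j` of the infinite tree that consists of
the ray `1, 2, 3, …` and a further vertex `0` attached at `2`. -/
def broomDist (i j : ℕ) : ℕ :=
  if i = j then 0
  else if i = 0 then 1 + ((j - 2) + (2 - j))
  else if j = 0 then 1 + ((i - 2) + (2 - i))
  else (i - j) + (j - i)

theorem broomDist_self (i : ℕ) : broomDist i i = 0 := by simp [broomDist]

theorem broomDist_comm (i j : ℕ) : broomDist i j = broomDist j i := by
  unfold broomDist; split_ifs <;> omega

theorem cast_tsub_add_tsub (a b : ℕ) : (((a - b) + (b - a) : ℕ) : ℝ) = |(a : ℝ) - b| := by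
  rcases le_total a b with h | h
  · rw [Nat.sub_eq_zero_of_le h, zero_add, Nat.cast_sub h, abs_sub_comm, abs_of_nonneg]
    simpa using h
  · rw [Nat.sub_eq_zero_of_le h, add_zero, Nat.cast_sub h, abs_of_nonneg]
    simpa using h

theorem broomDist_cast {i j : ℕ} (hi : i ≠ 0) (hj : j ≠ 0) :
    (broomDist i j : ℝ) = |(i : ℝ) - j| := by
  rw [← cast_tsub_add_tsub]
  unfold broomDist; split_ifs <;> simp_all

theorem broomDist_zero_cast {j : ℕ} (hj : j ≠ 0) :
    (broomDist 0 j : ℝ) = 1 + |(j : ℝ) - 2| := by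
  have := cast_tsub_add_tsub j 2
  push_cast at this
  rw [← this]
  unfold broomDist; split_ifs <;> simp_all

/-- Vertices `0` and `1` are twin leaves at `2`, so exchanging them is an isometry. -/
theorem broomDist_swap (i j : ℕ) :
    broomDist (Equiv.swap 0 1 i) (Equiv.swap 0 1 j) = broomDist i j := by
  simp only [Equiv.swap_apply_def]
  unfold broomDist; grind

/-! ### Domination by convex combinations of brooms -/

section Labelling

variable {V : Type*} [DecidableEq V]

/-- `σ` restricts to a bijection between `S` and an initial segment of the natural numbers. -/
def IsLabelling (S : Finset V) (σ : V → ℕ) : Prop :=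
  Set.InjOn σ S ∧ ∀ u ∈ S, σ u < S.card

/-- The tree metric that a labelling of the vertices induces. -/
def labelDist (σ : V → ℕ) (u v : V) : ℝ := broomDist (σ u) (σ v)

/-- The functions dominated on `S` by a convex combination of tree metrics `labelDist σ`. -/
def broomDominated (S : Finset V) : Set (V → V → ℝ) :=
  {d | ∃ e ∈ convexHull ℝ (labelDist '' {σ | IsLabelling S σ}), ∀ u ∈ S, ∀ v ∈ S, d u v ≤ e u v}

/-- The metric obtained from `e` by attaching a new vertex `w` to the vertex `c`. -/
def attachDist (w c : V) (e : V → V → ℝ) (u v : V) : ℝ :=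
  if u = w then (if v = w then 0 else 1 + e c v) else if v = w then 1 + e u c else e u v

omit [DecidableEq V] in
theorem IsLabelling.exists_eq {S : Finset V} {σ : V → ℕ} (h : IsLabelling S σ) {i : ℕ}
    (hi : i < S.card) : ∃ u ∈ S, σ u = i := by
  have := Finset.surj_on_of_inj_on_of_card_le (s := S) (t := Finset.range S.card)
    (fun u _ => σ u) (fun u hu => Finset.mem_range.2 (h.2 u hu))
    (fun a b ha hb hab => h.1 ha hb hab) (by simp) i (Finset.mem_range.2 hi)
  obtain ⟨u, hu, rfl⟩ := this
  exact ⟨u, hu, rfl⟩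

omit [DecidableEq V] in
theorem convex_broomDominated (S : Finset V) : Convex ℝ (broomDominated S) := by
  rintro d ⟨e, he, hd⟩ d' ⟨e', he', hd'⟩ a b ha hb hab
  refine ⟨a • e + b • e', convex_convexHull ℝ _ he he' ha hb hab, fun u hu v hv => ?_⟩
  have h1 := mul_le_mul_of_nonneg_left (hd u hu v hv) ha
  have h2 := mul_le_mul_of_nonneg_left (hd' u hu v hv) hb
  simpa using add_le_add h1 h2

omit [DecidableEq V] in
theorem broomDominated_of_le {S : Finset V} {d d' : V → V → ℝ} (h : d' ∈ broomDominated S)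
    (hd : ∀ u ∈ S, ∀ v ∈ S, d u v ≤ d' u v) : d ∈ broomDominated S := by
  obtain ⟨e, he, h⟩ := h
  exact ⟨e, he, fun u hu v hv => (hd u hu v hv).trans (h u hu v hv)⟩

omit [DecidableEq V] in
theorem IsLabelling.mem_broomDominated {S : Finset V} {σ : V → ℕ} (h : IsLabelling S σ) :
    labelDist σ ∈ broomDominated S :=
  ⟨_, subset_convexHull ℝ _ ⟨σ, h, rfl⟩, fun _ _ _ _ => le_rfl⟩

/-- A vertex attached at the far end just lengthens the path: `w` takes the next free label. -/
theorem attachDist_mem_of_label_last {S : Finset V} {σ : V → ℕ} (h : IsLabelling S σ) {w c : V}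
    (hw : w ∉ S) (hS : 4 ≤ S.card) (hc : σ c + 1 = S.card) :
    attachDist w c (labelDist σ) ∈ broomDominated (insert w S) := by
  have hne : ∀ {u}, u ∈ S → u ≠ w := fun hu e => hw (e ▸ hu)
  refine broomDominated_of_le (d' := labelDist (fun v => if v = w then S.card else σ v))
    (IsLabelling.mem_broomDominated ⟨?_, ?_⟩) ?_
  · intro u hu v hv huv
    simp only [Finset.coe_insert, Set.mem_insert_iff, Finset.mem_coe] at hu hv
    rcases hu with rfl | hu <;> rcases hv with rfl | hv
    · rfl
    · have := h.2 v hv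
      simp [hne hv] at huv; omega
    · have := h.2 u hu
      simp [hne hu] at huv; omega
    · simp only [hne hu, hne hv, if_false] at huv
      exact h.1 hu hv huv
  · intro u hu
    rw [Finset.card_insert_of_notMem hw]
    rcases Finset.mem_insert.1 hu with rfl | hu
    · simp
    · have := h.2 u hu
      simp only [hne hu, if_false]; omega
  · have key : ∀ v ∈ S, 1 + broomDist (σ c) (σ v) ≤ broomDist S.card (σ v) := by
      intro v hv
      have := h.2 v hv
      unfold broomDist; split_ifs <;> omega
    have key' : ∀ v ∈ S, (1 : ℝ) + broomDist (σ c) (σ v) ≤ broomDist S.card (σ v) :=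
      fun v hv => by exact_mod_cast key v hv
    intro u hu v hv
    rcases Finset.mem_insert.1 hu with rfl | hus <;> rcases Finset.mem_insert.1 hv with rfl | hvs
    · simp [attachDist, labelDist]
    · simpa [attachDist, labelDist, hne hvs] using key' v hvs
    · simpa [attachDist, labelDist, hne hus, broomDist_comm _ (σ c), broomDist_comm _ S.card]
        using key' u hus
    · simp [attachDist, labelDist, hne hus, hne hvs]

theorem abs_convex_le {s a b x y : ℝ} (h0 : 0 ≤ s) (h1 : s ≤ 1) (hx : x = (1 - s) * a + s * b) :
    |x - y| ≤ (1 - s) * |a - y| + s * |b - y| := by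
  have h : x - y = (1 - s) * (a - y) + s * (b - y) := by rw [hx]; ring
  rw [h]
  refine (abs_add_le _ _).trans ?_
  rw [abs_mul, abs_mul, abs_of_nonneg h0, abs_of_nonneg (sub_nonneg.2 h1)]

/-- Attaching `w` at the twin leaf `1` gives the path `w, 1, …, m` with the leaf `0` hanging at `2`,
one place too far inside. Convexity of the absolute value lets `0` be moved to hang at `1` or at `m
- 1`, with weights that keep its mean position at `2`; both results are brooms. They are `σ₁` and,
with the path reversed, `σ₂`. -/
theorem attachDist_mem_of_label_one {S : Finset V} {σ : V → ℕ} (h : IsLabelling S σ) {w c : V}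
    (hw : w ∉ S) (hS : 4 ≤ S.card) (hc : σ c = 1) :
    attachDist w c (labelDist σ) ∈ broomDominated (insert w S) := by
  have hne : ∀ {u}, u ∈ S → u ≠ w := fun hu e => hw (e ▸ hu)
  obtain ⟨m, hm⟩ : ∃ m, S.card = m + 1 := ⟨S.card - 1, by omega⟩
  have hm3 : 3 ≤ m := by omega
  set σ₁ : V → ℕ := fun v => if v = w then 1 else if σ v = 0 then 0 else σ v + 1 with hσ₁
  set σ₂ : V → ℕ := fun v => if v = w then m + 1 else if σ v = 0 then 0 else m + 1 - σ v with hσ₂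
  have hL₁ : IsLabelling (insert w S) σ₁ := by
    refine ⟨?_, ?_⟩
    · intro u hu v hv huv
      simp only [Finset.coe_insert, Set.mem_insert_iff, Finset.mem_coe] at hu hv
      simp only [hσ₁] at huv
      rcases hu with rfl | hu <;> rcases hv with rfl | hv
      · rfl
      · simp only [hne hv, if_true, if_false] at huv
        split_ifs at huv; omega
      · simp only [hne hu, if_true, if_false] at huv
        split_ifs at huv; omega
      · simp only [hne hu, hne hv, if_false] at huv
        refine h.1 hu hv ?_
        split_ifs at huv <;> omega
    · intro u hu
      rw [Finset.card_insert_of_notMem hw]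
      rcases Finset.mem_insert.1 hu with rfl | hu
      · simp only [hσ₁, if_true]; omega
      · have := h.2 u hu
        simp only [hσ₁, hne hu, if_false]
        split_ifs <;> omega
  have hL₂ : IsLabelling (insert w S) σ₂ := by
    refine ⟨?_, ?_⟩
    · intro u hu v hv huv
      simp only [Finset.coe_insert, Set.mem_insert_iff, Finset.mem_coe] at hu hv
      simp only [hσ₂] at huv
      rcases hu with rfl | hu <;> rcases hv with rfl | hv
      · rfl
      · have := h.2 v hv
        simp only [hne hv, if_true, if_false] at huv
        split_ifs at huv; omega
      · have := h.2 u hu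
        simp only [hne hu, if_true, if_false] at huv
        split_ifs at huv; omega
      · have := h.2 u hu
        have := h.2 v hv
        simp only [hne hu, hne hv, if_false] at huv
        refine h.1 hu hv ?_
        split_ifs at huv <;> omega
    · intro u hu
      rw [Finset.card_insert_of_notMem hw]
      rcases Finset.mem_insert.1 hu with rfl | hu
      · simp only [hσ₂, if_true]; omega
      · have := h.2 u hu
        simp only [hσ₂, hne hu, if_false]
        split_ifs <;> omega
  have hm2 : (0 : ℝ) < m - 2 := by
    have : (3 : ℝ) ≤ m := by exact_mod_cast hm3
    linarith
  -- Chosen so that `2 = (1 - s) * 1 + s * (m - 1)`.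
  set s : ℝ := 1 / (m - 2) with hs
  have hs0 : 0 ≤ s := by positivity
  have hs1 : s ≤ 1 := by
    rw [hs, div_le_one hm2]
    have : (3 : ℝ) ≤ m := by exact_mod_cast hm3
    linarith
  have hsm : s * (m - 2) = 1 := by rw [hs]; field_simp
  refine broomDominated_of_le (convex_broomDominated _ hL₁.mem_broomDominated
    hL₂.mem_broomDominated (sub_nonneg.2 hs1) hs0 (sub_add_cancel 1 s)) ?_
  have hwz : (1 : ℝ) + broomDist 1 0 ≤ (1 - s) * broomDist 1 0 + s * broomDist (m + 1) 0 := by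
    rw [broomDist_comm 1 0, broomDist_comm (m + 1) 0, broomDist_zero_cast one_ne_zero,
      broomDist_zero_cast (Nat.succ_ne_zero m)]
    push_cast
    rw [abs_of_nonneg (a := (m : ℝ) + 1 - 2) (by linarith), abs_of_nonpos (by norm_num)]
    nlinarith
  have hwv : ∀ j, 1 ≤ j → j ≤ m → (1 : ℝ) + broomDist 1 j ≤
      (1 - s) * broomDist 1 (j + 1) + s * broomDist (m + 1) (m + 1 - j) := by
    intro j h1 h2
    have h1' : (1 : ℝ) ≤ j := by exact_mod_cast h1
    rw [broomDist_cast one_ne_zero (by omega), broomDist_cast one_ne_zero (by omega),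
      broomDist_cast (by omega) (by omega), Nat.cast_sub (by omega)]
    push_cast
    rw [abs_of_nonpos (by linarith), abs_of_nonpos (by linarith), abs_of_nonneg (by linarith)]
    nlinarith
  have hzv : ∀ j, 1 ≤ j → j ≤ m → (broomDist 0 j : ℝ) ≤
      (1 - s) * broomDist 0 (j + 1) + s * broomDist 0 (m + 1 - j) := by
    intro j h1 h2
    rw [broomDist_zero_cast (by omega), broomDist_zero_cast (by omega),
      broomDist_zero_cast (by omega), Nat.cast_sub (by omega)]
    push_cast
    have := abs_convex_le (x := 2) (a := 1) (b := m - 1) (y := j) hs0 hs1 (by linarith)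
    rw [abs_sub_comm (j : ℝ) 2, show (j : ℝ) + 1 - 2 = -(1 - j) by ring, abs_neg,
      show (m : ℝ) + 1 - j - 2 = m - 1 - j by ring]
    linarith
  have huv : ∀ i j, 1 ≤ i → i ≤ m → 1 ≤ j → j ≤ m → (broomDist i j : ℝ) ≤
      (1 - s) * broomDist (i + 1) (j + 1) + s * broomDist (m + 1 - i) (m + 1 - j) := by
    intro i j h1 h2 h3 h4
    rw [broomDist_cast (by omega) (by omega), broomDist_cast (by omega) (by omega),
      broomDist_cast (by omega) (by omega), Nat.cast_sub (by omega), Nat.cast_sub (by omega)]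
    push_cast
    rw [show (i : ℝ) + 1 - (j + 1) = i - j by ring,
      show (m : ℝ) + 1 - i - (m + 1 - j) = -(i - j) by ring, abs_neg]
    linarith
  have hw' : ∀ v ∈ S, (1 : ℝ) + broomDist 1 (σ v) ≤
      (1 - s) * broomDist 1 (if σ v = 0 then 0 else σ v + 1) +
        s * broomDist (m + 1) (if σ v = 0 then 0 else m + 1 - σ v) := by
    intro v hv
    have := h.2 v hv
    rcases Nat.eq_zero_or_pos (σ v) with h0 | h0
    · simpa [h0] using hwz
    · simpa [h0.ne'] using hwv (σ v) h0 (by omega)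
  intro u hu v hv
  simp only [Pi.add_apply, Pi.smul_apply, smul_eq_mul]
  rcases Finset.mem_insert.1 hu with rfl | hus <;> rcases Finset.mem_insert.1 hv with rfl | hvs
  · simp [attachDist, labelDist, broomDist_self]
  · simpa [attachDist, labelDist, hne hvs, hc, hσ₁, hσ₂] using hw' v hvs
  · rw [labelDist, labelDist, broomDist_comm (σ₁ u), broomDist_comm (σ₂ u)]
    simpa [attachDist, labelDist, hne hus, hc, hσ₁, hσ₂, broomDist_comm (σ u)] using hw' u hus
  · have hus' := h.2 u hus
    have hvs' := h.2 v hvs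
    simp only [attachDist, labelDist, hne hus, hne hvs, hσ₁, hσ₂, if_false]
    by_cases h0 : σ u = 0 <;> by_cases h0' : σ v = 0
    · simp [h0, h0', broomDist_self]
    · simpa [h0, h0'] using hzv (σ v) (by omega) (by omega)
    · simpa [h0, h0', broomDist_comm _ 0] using hzv (σ u) (by omega) (by omega)
    · simpa [h0, h0'] using huv (σ u) (σ v) (by omega) (by omega) (by omega) (by omega)

/-- The distance from a path vertex `c` to any fixed vertex is convex in the position of `c`, so
attaching at `c` is dominated by a mixture of attaching at the two ends `1` and `m`. A vertex
labelled `0` is first relabelled `1` by the twin symmetry. -/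
theorem attachDist_mem {S : Finset V} {σ : V → ℕ} (h : IsLabelling S σ) {w c : V}
    (hw : w ∉ S) (hS : 4 ≤ S.card) (hcS : c ∈ S) :
    attachDist w c (labelDist σ) ∈ broomDominated (insert w S) := by
  have hne : ∀ {u}, u ∈ S → u ≠ w := fun hu e => hw (e ▸ hu)
  obtain ⟨m, hm⟩ : ∃ m, S.card = m + 1 := ⟨S.card - 1, by omega⟩
  have hm3 : (3 : ℝ) ≤ m := by exact_mod_cast (by omega : 3 ≤ m)
  rcases Nat.eq_zero_or_pos (σ c) with hc | hc
  · have hswap : labelDist σ = labelDist (fun v => Equiv.swap 0 1 (σ v)) := by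
      funext u v
      simp only [labelDist, broomDist_swap]
    rw [hswap]
    refine attachDist_mem_of_label_one ⟨?_, ?_⟩ hw hS (by simp [hc])
    · exact fun u hu v hv huv => h.1 hu hv ((Equiv.swap 0 1).injective huv)
    · intro u hu
      have := h.2 u hu
      simp only [Equiv.swap_apply_def]
      split_ifs <;> omega
  · obtain ⟨a, haS, ha⟩ := h.exists_eq (i := 1) (by omega)
    obtain ⟨b, hbS, hb⟩ := h.exists_eq (i := m) (by omega)
    have hcm := h.2 c hcS
    have hc1 : (1 : ℝ) ≤ σ c := by exact_mod_cast hc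
    have hcm' : (σ c : ℝ) ≤ m := by exact_mod_cast (by omega : σ c ≤ m)
    -- The position `σ c` is `(1 - s) * 1 + s * m`.
    set s : ℝ := (σ c - 1) / (m - 1) with hs
    have hs0 : 0 ≤ s := div_nonneg (by linarith) (by linarith)
    have hs1 : s ≤ 1 := by rw [hs, div_le_one (by linarith)]; linarith
    have hsm : s * (m - 1) = σ c - 1 := by
      rw [hs, div_mul_cancel₀]
      linarith
    refine broomDominated_of_le (convex_broomDominated _
      (attachDist_mem_of_label_one h hw hS ha)
      (attachDist_mem_of_label_last h (c := b) hw hS (by omega)) (sub_nonneg.2 hs1) hs0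
      (sub_add_cancel 1 s)) ?_
    have key : ∀ v ∈ S, (1 : ℝ) + broomDist (σ c) (σ v) ≤
        (1 - s) * (1 + broomDist 1 (σ v)) + s * (1 + broomDist m (σ v)) := by
      intro v hv
      rcases Nat.eq_zero_or_pos (σ v) with h0 | h0
      · rw [h0, broomDist_comm _ 0, broomDist_comm _ 0, broomDist_comm _ 0,
          broomDist_zero_cast hc.ne', broomDist_zero_cast one_ne_zero,
          broomDist_zero_cast (by omega)]
        have := abs_convex_le (x := σ c) (a := 1) (b := m) (y := 2) hs0 hs1 (by linarith)
        push_cast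
        linarith
      · rw [broomDist_cast hc.ne' h0.ne', broomDist_cast one_ne_zero h0.ne',
          broomDist_cast (by omega) h0.ne']
        have := abs_convex_le (x := σ c) (a := 1) (b := m) (y := σ v) hs0 hs1 (by linarith)
        push_cast
        linarith
    intro u hu v hv
    simp only [Pi.add_apply, Pi.smul_apply, smul_eq_mul]
    rcases Finset.mem_insert.1 hu with rfl | hus <;> rcases Finset.mem_insert.1 hv with rfl | hvs
    · simp [attachDist]
    · simpa [attachDist, labelDist, hne hvs, ha, hb] using key v hvs
    · simpa [attachDist, labelDist, hne hus, ha, hb, broomDist_comm (σ u)] using key u hus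
    · simp only [attachDist, labelDist, hne hus, hne hvs, if_false]
      linarith

/-- Attaching a vertex is affine and monotone in the metric, so the case of a single broom passes to
convex hulls. -/
theorem attachDist_mem_of_mem {S : Finset V} {e : V → V → ℝ} (he : e ∈ broomDominated S)
    {w c : V} (hw : w ∉ S) (hS : 4 ≤ S.card) (hcS : c ∈ S) :
    attachDist w c e ∈ broomDominated (insert w S) := by
  have hne : ∀ {u}, u ∈ S → u ≠ w := fun hu e => hw (e ▸ hu)
  obtain ⟨e', he', hle⟩ := he
  have hsub : convexHull ℝ (labelDist '' {σ | IsLabelling S σ}) ⊆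
      {e | attachDist w c e ∈ broomDominated (insert w S)} := by
    refine convexHull_min ?_ ?_
    · rintro _ ⟨σ, hσ, rfl⟩
      exact attachDist_mem hσ hw hS hcS
    · intro e₁ h₁ e₂ h₂ a b ha hb hab
      have : attachDist w c (a • e₁ + b • e₂) = a • attachDist w c e₁ + b • attachDist w c e₂ := by
        funext u v
        simp only [attachDist, Pi.add_apply, Pi.smul_apply, smul_eq_mul]
        -- The map is only affine, because of the constant `1` in `attachDist`; `a + b = 1` is
        -- essential.
        obtain rfl : a = 1 - b := by linarith
        split_ifs <;> ring
      rw [Set.mem_ofPred_eq, this]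
      exact convex_broomDominated _ h₁ h₂ ha hb hab
  refine broomDominated_of_le (hsub he') ?_
  intro u hu v hv
  rcases Finset.mem_insert.1 hu with rfl | hus <;> rcases Finset.mem_insert.1 hv with rfl | hvs
  · simp [attachDist]
  · simpa [attachDist, hne hvs] using hle c hcS v hvs
  · simpa [attachDist, hne hus] using hle u hus c hcS
  · simpa [attachDist, hne hus, hne hvs] using hle u hus v hvs

/-! ### Graph distances are dominated by brooms -/

namespace SimpleGraph

omit [DecidableEq V] in
theorem dist_le_one_add_of_adj {G : SimpleGraph V} (hG : G.Connected) {w c : V} (h : G.Adj w c)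
    (v : V) : G.dist w v ≤ 1 + G.dist c v := by
  have := hG.dist_triangle (u := w) (v := c) (w := v)
  rwa [dist_eq_one_iff_adj.2 h] at this

/-- On four vertices the broom is the star `K₁,₃`, with centre labelled `2`. -/
theorem dist_mem_broomDominated_of_star {G : SimpleGraph V} (hG : G.Connected) {c a₁ a₂ a₃ : V}
    (h₁ : G.Adj c a₁) (h₂ : G.Adj c a₂) (h₃ : G.Adj c a₃) (h₁₂ : a₁ ≠ a₂) (h₁₃ : a₁ ≠ a₃)
    (h₂₃ : a₂ ≠ a₃) :
    (fun u v => (G.dist u v : ℝ)) ∈ broomDominated {c, a₁, a₂, a₃} := by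
  have hcard : ({c, a₁, a₂, a₃} : Finset V).card = 4 := by
    rw [Finset.card_insert_of_notMem, Finset.card_insert_of_notMem, Finset.card_pair h₂₃] <;>
      simp [h₁.ne, h₂.ne, h₃.ne, h₁₂, h₁₃]
  set σ : V → ℕ := fun v => if v = c then 2 else if v = a₁ then 0 else if v = a₂ then 1 else 3
    with hσ
  have e₀ : σ c = 2 := by simp [hσ]
  have e₁ : σ a₁ = 0 := by simp [hσ, h₁.ne']
  have e₂ : σ a₂ = 1 := by simp [hσ, h₂.ne', h₁₂.symm]
  have e₃ : σ a₃ = 3 := by simp [hσ, h₃.ne', h₁₃.symm, h₂₃.symm]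
  have hL : IsLabelling {c, a₁, a₂, a₃} σ := by
    refine ⟨?_, ?_⟩
    · intro u hu v hv huv
      simp only [Finset.coe_insert, Finset.coe_singleton, Set.mem_insert_iff,
        Set.mem_singleton_iff] at hu hv
      rcases hu with rfl | rfl | rfl | rfl <;> rcases hv with rfl | rfl | rfl | rfl <;>
        first | rfl | (exfalso; omega)
    · intro u hu
      rw [hcard]
      simp only [Finset.mem_insert, Finset.mem_singleton] at hu
      rcases hu with rfl | rfl | rfl | rfl <;> omega
  refine broomDominated_of_le hL.mem_broomDominated ?_
  have d₁ := dist_eq_one_iff_adj.2 h₁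
  have d₂ := dist_eq_one_iff_adj.2 h₂
  have d₃ := dist_eq_one_iff_adj.2 h₃
  have d₁₂ := dist_le_one_add_of_adj hG h₁.symm a₂
  have d₁₃ := dist_le_one_add_of_adj hG h₁.symm a₃
  have d₂₃ := dist_le_one_add_of_adj hG h₂.symm a₃
  intro u hu v hv
  simp only [Finset.mem_insert, Finset.mem_singleton] at hu hv
  simp only [labelDist, Nat.cast_le]
  rcases hu with rfl | rfl | rfl | rfl <;> rcases hv with rfl | rfl | rfl | rfl <;>
    simp only [dist_self, Nat.zero_le, e₀, e₁, e₂, e₃] <;>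
    first
      | (simp only [broomDist]; norm_num; omega)
      | (rw [dist_comm]; simp only [broomDist]; norm_num; omega)

omit [DecidableEq V] in
theorem Connected.exists_adj_boundary {G : SimpleGraph V} (hG : G.Connected) {S : Finset V}
    {a b : V} (ha : a ∈ S) (hb : b ∉ S) : ∃ c ∈ S, ∃ w ∉ S, G.Adj w c := by
  obtain ⟨p⟩ := hG.preconnected a b
  obtain ⟨d, -, h1, h2⟩ := p.exists_boundary_dart (S : Set V) ha hb
  exact ⟨d.fst, h1, d.snd, h2, d.adj.symm⟩

/-- Starting from the star, the vertex set grows by one `w` adjacent to some `c` already present.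
The triangle inequality `d(w, v) ≤ 1 + d(c, v)` puts the distances below those of attaching `w` at
`c`. -/
theorem dist_mem_broomDominated [Fintype V] {G : SimpleGraph V} (hG : G.Connected)
    {c a₁ a₂ a₃ : V} (h₁ : G.Adj c a₁) (h₂ : G.Adj c a₂) (h₃ : G.Adj c a₃) (h₁₂ : a₁ ≠ a₂)
    (h₁₃ : a₁ ≠ a₃) (h₂₃ : a₂ ≠ a₃) :
    (fun u v => (G.dist u v : ℝ)) ∈ broomDominated (Finset.univ : Finset V) := by
  have hcard : ({c, a₁, a₂, a₃} : Finset V).card = 4 := by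
    rw [Finset.card_insert_of_notMem, Finset.card_insert_of_notMem, Finset.card_pair h₂₃] <;>
      simp [h₁.ne, h₂.ne, h₃.ne, h₁₂, h₁₃]
  have key : ∀ k, 4 ≤ k → k ≤ Fintype.card V → ∃ S : Finset V, S.card = k ∧
      (fun u v => (G.dist u v : ℝ)) ∈ broomDominated S := by
    intro k hk
    induction k, hk using Nat.le_induction with
    | base =>
      exact fun _ => ⟨_, hcard, dist_mem_broomDominated_of_star hG h₁ h₂ h₃ h₁₂ h₁₃ h₂₃⟩
    | succ k hk ih =>
      intro hkV
      obtain ⟨S, hS, hmem⟩ := ih (by omega)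
      obtain ⟨a, ha⟩ : S.Nonempty := Finset.card_pos.1 (by omega)
      obtain ⟨b, hb⟩ : ∃ b, b ∉ S := by
        by_contra! hall
        rw [Finset.eq_univ_iff_forall.2 hall, Finset.card_univ] at hS
        omega
      obtain ⟨c, hc, w, hw, hwc⟩ := hG.exists_adj_boundary ha hb
      refine ⟨insert w S, by rw [Finset.card_insert_of_notMem hw, hS],
        broomDominated_of_le (attachDist_mem_of_mem hmem hw (by omega) hc) ?_⟩
      have hadj := dist_le_one_add_of_adj hG hwc
      have hadj' : ∀ v, (G.dist w v : ℝ) ≤ 1 + G.dist c v := fun v => by exact_mod_cast hadj v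
      intro u _ v _
      unfold attachDist
      split_ifs with hu hv hv
      · rw [hu, hv]; simp
      · rw [hu]; exact hadj' v
      · rw [hv, dist_comm]; simpa only [dist_comm (v := c)] using hadj' u
      · exact le_rfl
  obtain ⟨S, hS, h⟩ := key _ (hcard ▸ Finset.card_le_univ _) le_rfl
  rwa [(Finset.card_eq_iff_eq_univ S).1 hS] at h

end SimpleGraph

end Labelling

/-! ### Distance sums and edge cuts of the broom -/

section BroomSpectrum

open Finset

/-- Row sums of the distance matrix of the broom with vertices `0, …, n - 1`. -/
def broomTransmission (n i : ℕ) : ℝ := ∑ j ∈ range n, (broomDist i j : ℝ)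

/-- The distance matrix of the broom with vertices `0, …, n - 1`, applied to a vector. -/
def broomRow (n : ℕ) (Z : ℕ → ℝ) (i : ℕ) : ℝ := ∑ j ∈ range n, (broomDist i j : ℝ) * Z j

/-- The distance Laplacian of the broom with vertices `0, …, n - 1`, applied to a vector. -/
def broomLaplacian (n : ℕ) (Z : ℕ → ℝ) (i : ℕ) : ℝ := broomTransmission n i * Z i - broomRow n Z i

theorem broomRow_one (n i : ℕ) : broomRow n (fun _ => 1) i = broomTransmission n i := by
  simp [broomRow, broomTransmission]

theorem sum_range_ite_lt {n k : ℕ} (h : k ≤ n) (Z : ℕ → ℝ) :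
    ∑ j ∈ range n, (if j < k then -1 else 1) * Z j = ∑ j ∈ range n, Z j - 2 * ∑ j ∈ range k, Z j := by
  have h1 := sum_range_add_sum_Ico (fun j => (if j < k then -1 else 1) * Z j) h
  have h2 := sum_range_add_sum_Ico Z h
  have h3 : ∑ j ∈ range k, (if j < k then -1 else 1) * Z j = - ∑ j ∈ range k, Z j := by
    rw [← sum_neg_distrib]
    exact sum_congr rfl fun j hj => by simp [mem_range.1 hj]
  have h4 : ∑ j ∈ Ico k n, (if j < k then -1 else 1) * Z j = ∑ j ∈ Ico k n, Z j :=
    sum_congr rfl fun j hj => by simp [(mem_Ico.1 hj).1]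
  linarith

/-- Crossing the edge from `i` to `i + 1` changes each distance by one, with a sign given by the
side of the cut. -/
theorem broomRow_sub_succ {n i : ℕ} (hi : 2 ≤ i) (hin : i + 1 < n) (Z : ℕ → ℝ) :
    broomRow n Z i - broomRow n Z (i + 1) =
      ∑ j ∈ range n, Z j - 2 * ∑ j ∈ range (i + 1), Z j := by
  rw [← sum_range_ite_lt hin.le, broomRow, broomRow, ← sum_sub_distrib]
  refine sum_congr rfl fun j _ => ?_
  rw [← sub_mul]
  congr 1
  split_ifs with h
  · have : broomDist (i + 1) j = broomDist i j + 1 := by unfold broomDist; grind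
    rw [this]; push_cast; ring
  · have : broomDist i j = broomDist (i + 1) j + 1 := by unfold broomDist; grind
    rw [this]; push_cast; ring

theorem broomRow_sub_two {n k : ℕ} (hk : k < 2) (hn : 2 ≤ n) (Z : ℕ → ℝ) :
    broomRow n Z k - broomRow n Z 2 = ∑ j ∈ range n, Z j - 2 * Z k := by
  have h : 2 * Z k = ∑ j ∈ range n, if j = k then 2 * Z j else 0 := by
    rw [sum_ite_eq', if_pos (mem_range.2 (by omega))]
  rw [h, broomRow, broomRow, ← sum_sub_distrib, ← sum_sub_distrib]
  refine sum_congr rfl fun j _ => ?_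
  rw [← sub_mul]
  split_ifs with h
  · have : broomDist 2 j = broomDist k j + 1 := by unfold broomDist; grind
    rw [this]; push_cast; ring
  · have : broomDist k j = broomDist 2 j + 1 := by unfold broomDist; grind
    rw [this]; push_cast; ring

/-- Abel summation along the path, with both twins compared to their neighbour `2`. -/
theorem sum_broomRow_mul {n m : ℕ} (hm : 2 ≤ m) (Z : ℕ → ℝ) :
    ∑ i ∈ range (m + 1), broomRow n Z i * Z i =
      broomRow n Z m * ∑ j ∈ range (m + 1), Z j
      + ∑ k ∈ Ico 2 m, (broomRow n Z k - broomRow n Z (k + 1)) * ∑ j ∈ range (k + 1), Z j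
      + (broomRow n Z 0 - broomRow n Z 2) * Z 0 + (broomRow n Z 1 - broomRow n Z 2) * Z 1 := by
  induction m, hm using Nat.le_induction with
  | base => simp [sum_range_succ]; ring
  | succ m hm ih =>
    rw [sum_range_succ, ih, sum_Ico_succ_top hm, sum_range_succ _ (m + 1)]
    ring

/-- The quadratic form of the distance matrix of a tree in terms of the edge cuts. -/
theorem sum_broomRow_mul_eq_neg {n : ℕ} (hn : 3 ≤ n) {Z : ℕ → ℝ} (hZ : ∑ j ∈ range n, Z j = 0) :
    ∑ i ∈ range n, broomRow n Z i * Z i =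
      -2 * (∑ k ∈ Ico 2 (n - 1), (∑ j ∈ range (k + 1), Z j) ^ 2 + Z 0 ^ 2 + Z 1 ^ 2) := by
  obtain ⟨m, rfl⟩ : ∃ m, n = m + 1 := ⟨n - 1, by omega⟩
  rw [sum_broomRow_mul (by omega), hZ, broomRow_sub_two (by omega) (by omega),
    broomRow_sub_two (by omega) (by omega), hZ, Nat.add_sub_cancel]
  have : ∑ k ∈ Ico 2 m, (broomRow (m + 1) Z k - broomRow (m + 1) Z (k + 1)) *
      ∑ j ∈ range (k + 1), Z j = ∑ k ∈ Ico 2 m, -2 * (∑ j ∈ range (k + 1), Z j) ^ 2 := by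
    refine sum_congr rfl fun k hk => ?_
    have := mem_Ico.1 hk
    rw [broomRow_sub_succ this.1 (by omega), hZ]; ring
  rw [this, ← mul_sum]
  ring

theorem broomTransmission_sub_succ {n i : ℕ} (hi : 2 ≤ i) (hin : i + 1 < n) :
    broomTransmission n i - broomTransmission n (i + 1) = n - 2 * (i + 1) := by
  rw [← broomRow_one, ← broomRow_one, broomRow_sub_succ hi hin]
  simp

theorem broomTransmission_sub_two {n k : ℕ} (hk : k < 2) (hn : 2 ≤ n) :
    broomTransmission n k - broomTransmission n 2 = n - 2 := by
  rw [← broomRow_one, ← broomRow_one, broomRow_sub_two hk hn]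
  simp

theorem broomTransmission_nonneg (n i : ℕ) : 0 ≤ broomTransmission n i :=
  sum_nonneg fun _ _ => Nat.cast_nonneg _

theorem broomTransmission_one_eq {n : ℕ} (hn : 2 ≤ n) :
    broomTransmission n 1 = 2 + (n - 1) * (n - 2) / 2 := by
  unfold broomTransmission
  induction n, hn using Nat.le_induction with
  | base => simp [sum_range_succ, broomDist]
  | succ n hn ih =>
    rw [sum_range_succ, ih, broomDist_cast one_ne_zero (by omega), abs_of_nonpos]
    · push_cast; ring
    · have : (2 : ℝ) ≤ n := by exact_mod_cast hn
      push_cast; linarith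

theorem broomTransmission_last_eq {m : ℕ} (hm : 2 ≤ m) :
    broomTransmission (m + 1) m = (m - 1) * (m + 2) / 2 := by
  have key : ∀ k, 1 ≤ k → k ≤ m + 1 →
      ∑ j ∈ range k, (broomDist m j : ℝ) = (m - 1) + m * (k - 1) - k * (k - 1) / 2 := by
    intro k hk
    induction k, hk using Nat.le_induction with
    | base =>
      intro _
      have : (2 : ℝ) ≤ m := by exact_mod_cast hm
      rw [sum_range_one, broomDist_comm, broomDist_zero_cast (by omega), abs_of_nonneg (by linarith)]
      push_cast; ring
    | succ k hk ih =>
      intro hkm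
      have : (k : ℝ) ≤ m := by exact_mod_cast (by omega : k ≤ m)
      rw [sum_range_succ, ih (by omega), broomDist_cast (by omega) (by omega),
        abs_of_nonneg (by linarith)]
      push_cast; ring
  rw [broomTransmission, key _ (by omega) le_rfl]
  push_cast; ring

theorem sum_broomLaplacian (n : ℕ) (Z : ℕ → ℝ) : ∑ i ∈ range n, broomLaplacian n Z i = 0 := by
  simp only [broomLaplacian, broomRow, broomTransmission, sum_sub_distrib, sum_mul]
  rw [sub_eq_zero, sum_comm]
  refine sum_congr rfl fun i _ => sum_congr rfl fun j _ => ?_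
  rw [broomDist_comm]

/-! ### Top eigenvectors of the broom -/

/-- `X` is an eigenvector for the largest eigenvalue `ρ` of the distance Laplacian of the broom
with vertices `0, …, n - 1`. -/
structure IsTopBroomVector (n : ℕ) (ρ : ℝ) (X : ℕ → ℝ) : Prop where
  eigen : ∀ i < n, broomLaplacian n X i = ρ * X i
  le : ∀ Z : ℕ → ℝ, ∑ i ∈ range n, broomLaplacian n Z i * Z i ≤ ρ * ∑ i ∈ range n, Z i ^ 2
  eigen_of_eq : ∀ Z : ℕ → ℝ, ∑ i ∈ range n, broomLaplacian n Z i * Z i = ρ * ∑ i ∈ range n, Z i ^ 2 →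
    ∀ i < n, broomLaplacian n Z i = ρ * Z i

namespace IsTopBroomVector

variable {n : ℕ} {ρ : ℝ} {X : ℕ → ℝ}

theorem neg (h : IsTopBroomVector n ρ X) : IsTopBroomVector n ρ (fun i => -X i) := by
  refine ⟨fun i hi => ?_, h.le, h.eigen_of_eq⟩
  have := h.eigen i hi
  simp only [broomLaplacian, broomRow, mul_neg, sum_neg_distrib] at this ⊢
  linarith

/-- Rayleigh quotient of `n e_v - 1`: the Laplacian kills constants, so the form is `n² Tr(v)`,
against squared norm `n (n - 1)`. -/
theorem transmission_le (h : IsTopBroomVector n ρ X) {v : ℕ} (hv : v < n) :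
    n * broomTransmission n v ≤ ρ * (n - 1) := by
  have hn : (0 : ℝ) < n := by exact_mod_cast (by omega : 0 < n)
  set Z : ℕ → ℝ := fun j => (if j = v then (n : ℝ) else 0) - 1 with hZ
  have hL : ∀ i, broomLaplacian n Z i =
      n * (if i = v then broomTransmission n v else 0) - n * broomDist i v := by
    intro i
    have : broomRow n Z i = n * broomDist i v - broomTransmission n i := by
      simp only [broomRow, hZ, mul_sub, sum_sub_distrib, mul_ite, mul_zero, sum_ite_eq', mul_one,
        mem_range, hv, if_true, broomTransmission]
      ring
    rw [broomLaplacian, this]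
    simp only [hZ]
    split_ifs with hi
    · subst hi; ring
    · ring
  have h1 : ∑ i ∈ range n, broomLaplacian n Z i * Z i = n * (n * broomTransmission n v) := by
    have h2 : ∀ i ∈ range n, broomLaplacian n Z i * Z i =
        (if i = v then n * (n * broomTransmission n v - n * broomDist v v) else 0)
          - broomLaplacian n Z i := by
      intro i _
      rw [hL]
      simp only [hZ]
      split_ifs with hi
      · subst hi; ring
      · ring
    rw [sum_congr rfl h2, sum_sub_distrib, sum_broomLaplacian, sum_ite_eq',
      if_pos (mem_range.2 hv), broomDist_self]
    push_cast; ring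
  have h2 : ∑ i ∈ range n, Z i ^ 2 = n * (n - 1) := by
    have h3 : ∀ i ∈ range n, Z i ^ 2 = (if i = v then (n : ℝ) ^ 2 - 2 * n else 0) + 1 := by
      intro i _
      simp only [hZ]
      split_ifs <;> ring
    rw [sum_congr rfl h3, sum_add_distrib, sum_ite_eq', if_pos (mem_range.2 hv)]
    simp; ring
  have := h.le Z
  rw [h1, h2] at this
  nlinarith

/-- The last vertex is the test: its transmission exceeds that of `1` by `n - 4`, and the factor `n
/ (n - 1)` supplies the rest. This makes the coefficient in `step_two` positive. -/
theorem rho_gt (h : IsTopBroomVector n ρ X) (hn : 5 ≤ n) :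
    broomTransmission n 1 + 2 < ρ := by
  obtain ⟨m, rfl⟩ : ∃ m, n = m + 1 := ⟨n - 1, by omega⟩
  have hm : (4 : ℝ) ≤ m := by exact_mod_cast (by omega : 4 ≤ m)
  have := h.transmission_le (v := m) (by omega)
  rw [broomTransmission_last_eq (by omega)] at this
  rw [broomTransmission_one_eq (by omega)]
  push_cast at this ⊢
  nlinarith

theorem transmission_lt (h : IsTopBroomVector n ρ X) (hn : 5 ≤ n) {i : ℕ} (hi : i < n) :
    broomTransmission n i < ρ := by
  have h1 := h.rho_gt hn
  have h2 := broomTransmission_nonneg n 1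
  have h3 := h.transmission_le hi
  have h4 : (5 : ℝ) ≤ n := by exact_mod_cast hn
  nlinarith

theorem sum_eq_zero (h : IsTopBroomVector n ρ X) (hn : 5 ≤ n) : ∑ i ∈ range n, X i = 0 := by
  have h1 := h.rho_gt hn
  have h2 := broomTransmission_nonneg n 1
  have h3 := sum_broomLaplacian n X
  rw [sum_congr rfl fun i hi => h.eigen i (mem_range.1 hi), ← mul_sum] at h3
  rcases mul_eq_zero.1 h3 with h3 | h3
  · linarith
  · exact h3

theorem row_eq (h : IsTopBroomVector n ρ X) {i : ℕ} (hi : i < n) :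
    (ρ - broomTransmission n i) * X i = -broomRow n X i := by
  have := h.eigen i hi
  rw [broomLaplacian] at this
  linarith

/-- Difference of the eigenvalue equations at the two ends of an edge; the sum is that over one side
of the cut. -/
theorem step (h : IsTopBroomVector n ρ X) (hn : 5 ≤ n) {i : ℕ} (hi : 2 ≤ i) (hin : i + 1 < n) :
    (ρ - broomTransmission n (i + 1)) * X (i + 1) =
      (ρ - broomTransmission n i) * X i - 2 * ∑ j ∈ range (i + 1), X j := by
  have h1 := broomRow_sub_succ hi hin X
  rw [h.sum_eq_zero hn] at h1
  rw [h.row_eq hin, h.row_eq (by omega)]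
  linarith

theorem step_two (h : IsTopBroomVector n ρ X) (hn : 5 ≤ n) {k : ℕ} (hk : k < 2) :
    (ρ - broomTransmission n 2) * X 2 = (ρ - broomTransmission n 1 - 2) * X k := by
  have h1 := broomRow_sub_two (n := n) hk (by omega) X
  have h2 := h.row_eq (i := k) (by omega)
  have h3 := broomTransmission_sub_two (n := n) hk (by omega)
  have h4 := broomTransmission_sub_two (n := n) (k := 1) (by omega) (by omega)
  rw [h.sum_eq_zero hn] at h1
  rw [h.row_eq (by omega)]
  have : broomTransmission n 1 = broomTransmission n k := by linarith
  rw [this]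
  linarith

theorem zero_eq_one (h : IsTopBroomVector n ρ X) (hn : 5 ≤ n) : X 0 = X 1 := by
  have h0 := h.step_two hn (k := 0) (by omega)
  have h1 := h.step_two hn (k := 1) (by omega)
  have := h.rho_gt hn
  exact mul_left_cancel₀ (by linarith : ρ - broomTransmission n 1 - 2 ≠ 0) (h0.symm.trans h1)

/-- A top eigenvector is determined by its value at the twin leaves. -/
theorem eq_of_one_eq {Y : ℕ → ℝ} (hX : IsTopBroomVector n ρ X) (hY : IsTopBroomVector n ρ Y)
    (hn : 5 ≤ n) (h1 : X 1 = Y 1) {i : ℕ} (hi : i < n) : X i = Y i := by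
  have h0 : X 0 = Y 0 := by rw [hX.zero_eq_one hn, hY.zero_eq_one hn, h1]
  have key : ∀ i, 2 ≤ i → i < n →
      X i = Y i ∧ ∑ j ∈ range (i + 1), X j = ∑ j ∈ range (i + 1), Y j := by
    intro i hi
    induction i, hi using Nat.le_induction with
    | base =>
      intro h2
      have h3 : X 2 = Y 2 := by
        refine mul_left_cancel₀ (sub_ne_zero.2 (hX.transmission_lt hn h2).ne') ?_
        rw [hX.step_two hn (k := 1) (by omega), hY.step_two hn (k := 1) (by omega), h1]
      exact ⟨h3, by simp [sum_range_succ, h0, h1, h3]⟩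
    | succ i hi ih =>
      intro hin
      obtain ⟨h3, h4⟩ := ih (by omega)
      have h5 : X (i + 1) = Y (i + 1) := by
        refine mul_left_cancel₀ (sub_ne_zero.2 (hX.transmission_lt hn hin).ne') ?_
        rw [hX.step hn hi hin, hY.step hn hi hin, h3, h4]
      exact ⟨h5, by rw [sum_range_succ, h4, h5, sum_range_succ _ (i + 1)]⟩
  match i with
  | 0 => exact h0
  | 1 => exact h1
  | i + 2 => exact (key (i + 2) (by omega) hi).1

theorem one_ne_zero (h : IsTopBroomVector n ρ X) (hn : 5 ≤ n) (hX : ∃ i < n, X i ≠ 0) :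
    X 1 ≠ 0 := by
  intro h1
  obtain ⟨i, hi, hXi⟩ := hX
  -- `IsTopBroomVector` does not require a nonzero vector, so uniqueness can be applied against `0`.
  have h0 : IsTopBroomVector n ρ (fun _ => 0) :=
    ⟨fun i _ => by simp [broomLaplacian, broomRow], h.le, h.eigen_of_eq⟩
  exact hXi (h.eq_of_one_eq h0 hn h1 hi)

/-- The vector whose edge cut sums are the absolute values of those of `X`. -/
theorem exists_abs (h : IsTopBroomVector n ρ X) (hn : 5 ≤ n) (h1 : 0 < X 1) :
    ∃ Y : ℕ → ℝ, IsTopBroomVector n ρ Y ∧ Y 1 = X 1 ∧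
      ∀ i, 2 ≤ i → i < n → ∑ j ∈ range (i + 1), Y j = |∑ j ∈ range (i + 1), X j| := by
  set S : ℕ → ℝ := fun i => ∑ j ∈ range (i + 1), X j with hS
  have hS0 : S (n - 1) = 0 := by
    rw [hS]
    simp only
    rw [Nat.sub_add_cancel (by omega), h.sum_eq_zero hn]
  have hX0 : X 0 = X 1 := h.zero_eq_one hn
  have hSsucc : ∀ i, S (i + 1) = S i + X (i + 1) := fun i => sum_range_succ _ _
  have hS1 : S 1 = 2 * X 1 := by simp [hS, sum_range_succ, hX0]; ring
  set Y : ℕ → ℝ := fun i => if i < 2 then X 1 else |S i| - |S (i - 1)| with hY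
  have hYS : ∀ i, 1 ≤ i → ∑ j ∈ range (i + 1), Y j = |S i| := by
    intro i hi
    induction i, hi using Nat.le_induction with
    | base =>
      rw [hS1, abs_of_pos (by linarith)]
      simp [sum_range_succ, hY]; ring
    | succ i hi ih =>
      rw [sum_range_succ, ih, hY]
      simp only [if_neg (show ¬ i + 1 < 2 by omega), Nat.add_sub_cancel]
      ring
  have hYsum : ∑ j ∈ range n, Y j = 0 := by
    have := hYS (n - 1) (by omega)
    rwa [Nat.sub_add_cancel (by omega), hS0, abs_zero] at this
  -- Entries are differences of consecutive cut sums, and `||a| - |b|| ≤ |a - b|`.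
  have hle : ∀ i, Y i ^ 2 ≤ X i ^ 2 := by
    intro i
    rw [hY]
    simp only
    split_ifs with hi
    · interval_cases i
      · rw [hX0]
      · rfl
    · obtain ⟨k, rfl⟩ : ∃ k, i = k + 1 := ⟨i - 1, by omega⟩
      have : X (k + 1) = S (k + 1) - S k := by rw [hSsucc]; ring
      rw [this, Nat.add_sub_cancel, sq_le_sq]
      exact abs_abs_sub_abs_le_abs_sub _ _
  -- The Rayleigh deficit as a diagonal part with positive coefficients minus cut squares. Passing
  -- from `X` to `Y` keeps the cut squares and does not increase the diagonal part, so the deficit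
  -- stays zero.
  have hform : ∀ Z : ℕ → ℝ, ∑ j ∈ range n, Z j = 0 →
      ρ * ∑ i ∈ range n, Z i ^ 2 - ∑ i ∈ range n, broomLaplacian n Z i * Z i =
      ∑ i ∈ range n, (ρ - broomTransmission n i) * Z i ^ 2 -
      2 * (∑ k ∈ Ico 2 (n - 1), (∑ j ∈ range (k + 1), Z j) ^ 2 + Z 0 ^ 2 + Z 1 ^ 2) := by
    intro Z hZ
    have h2 := sum_broomRow_mul_eq_neg (by omega) hZ
    have h3 : ∑ i ∈ range n, (ρ - broomTransmission n i) * Z i ^ 2 =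
        ρ * ∑ i ∈ range n, Z i ^ 2 - ∑ i ∈ range n, broomLaplacian n Z i * Z i
          - ∑ i ∈ range n, broomRow n Z i * Z i := by
      rw [mul_sum, ← sum_sub_distrib, ← sum_sub_distrib]
      exact sum_congr rfl fun i _ => by rw [broomLaplacian]; ring
    linarith
  have hXform := hform X (h.sum_eq_zero hn)
  have hXeq : ∑ i ∈ range n, broomLaplacian n X i * X i = ρ * ∑ i ∈ range n, X i ^ 2 := by
    rw [mul_sum]
    exact sum_congr rfl fun i hi => by rw [h.eigen i (mem_range.1 hi)]; ring
  have hYform := hform Y hYsum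
  have hcut : ∑ k ∈ Ico 2 (n - 1), (∑ j ∈ range (k + 1), Y j) ^ 2 =
      ∑ k ∈ Ico 2 (n - 1), (∑ j ∈ range (k + 1), X j) ^ 2 :=
    sum_congr rfl fun k hk => by
      rw [hYS k (by have := mem_Ico.1 hk; omega), sq_abs]
  have hY0 : Y 0 = X 0 := by simp [hY, hX0]
  have hY1 : Y 1 = X 1 := by simp [hY]
  have hsum : ∑ i ∈ range n, (ρ - broomTransmission n i) * Y i ^ 2 ≤
      ∑ i ∈ range n, (ρ - broomTransmission n i) * X i ^ 2 :=
    sum_le_sum fun i hi => mul_le_mul_of_nonneg_left (hle i)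
      (sub_nonneg.2 (h.transmission_lt hn (mem_range.1 hi)).le)
  rw [hcut, hY0, hY1] at hYform
  have hYeq : ∑ i ∈ range n, broomLaplacian n Y i * Y i = ρ * ∑ i ∈ range n, Y i ^ 2 := by
    have := h.le Y
    linarith
  exact ⟨Y, ⟨h.eigen_of_eq Y hYeq, h.le, h.eigen_of_eq⟩, hY1, fun i hi _ => hYS i (by omega)⟩

/-- A Perron–Frobenius argument: the vector from `exists_abs` agrees with `X` at `1`, hence
everywhere, so the cut sums are nonnegative. A first zero cut sum would lie between a negative entry
and a nonnegative one, contradicting `step`. -/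
theorem prefix_pos (h : IsTopBroomVector n ρ X) (hn : 5 ≤ n) (h1 : 0 < X 1) {i : ℕ} (hi : 2 ≤ i)
    (hin : i + 1 < n) : 0 < ∑ j ∈ range (i + 1), X j := by
  obtain ⟨Y, hY, hY1, hYS⟩ := h.exists_abs hn h1
  have hnonneg : ∀ i, 2 ≤ i → i < n → 0 ≤ ∑ j ∈ range (i + 1), X j := by
    intro i hi hin
    have : ∑ j ∈ range (i + 1), X j = ∑ j ∈ range (i + 1), Y j :=
      sum_congr rfl fun j hj =>
        (hY.eq_of_one_eq h hn hY1 (by have := mem_range.1 hj; omega)).symm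
    rw [this, hYS i hi hin]
    exact abs_nonneg _
  induction i, hi using Nat.le_induction with
  | base =>
    have h2 := h.step_two hn (k := 1) (by omega)
    have h3 := h.rho_gt hn
    have h4 := h.transmission_lt hn (i := 2) (by omega)
    have h5 : 0 < X 2 := by
      refine pos_of_mul_pos_right (a := ρ - broomTransmission n 2) ?_ (by linarith)
      rw [h2]
      exact mul_pos (by linarith) h1
    simp only [sum_range_succ, range_zero, sum_empty, h.zero_eq_one hn]
    linarith
  | succ i hi ih =>
    have h2 := ih (by omega)
    refine lt_of_le_of_ne (hnonneg (i + 1) (by omega) (by omega)) fun h0 => ?_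
    have h3 : X (i + 1) < 0 := by
      rw [sum_range_succ] at h0; linarith
    have h4 : 0 ≤ X (i + 1 + 1) := by
      have := hnonneg (i + 1 + 1) (by omega) (by omega)
      rw [sum_range_succ, ← h0] at this; linarith
    have h5 := h.step hn (i := i + 1) (by omega) (by omega)
    rw [← h0] at h5
    have h6 := mul_nonneg (sub_nonneg.2 (h.transmission_lt hn hin).le) h4
    have h7 := mul_neg_of_pos_of_neg
      (sub_pos.2 (h.transmission_lt hn (i := i + 1) (by omega))) h3
    linarith

theorem scaled_lt (h : IsTopBroomVector n ρ X) (hn : 5 ≤ n) (h1 : 0 < X 1) {i : ℕ} (hi : 2 ≤ i)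
    (hin : i + 1 < n) : (ρ - broomTransmission n (i + 1)) * X (i + 1) <
      (ρ - broomTransmission n i) * X i := by
  have := h.step hn hi hin
  have := h.prefix_pos hn h1 hi hin
  linarith

theorem pos_of_succ_nonneg (h : IsTopBroomVector n ρ X) (hn : 5 ≤ n) (h1 : 0 < X 1) {i : ℕ}
    (hi : 2 ≤ i) (hin : i + 1 < n) (hX : 0 ≤ X (i + 1)) : 0 < X i := by
  have h2 := h.scaled_lt hn h1 hi hin
  have h3 := mul_nonneg (sub_nonneg.2 (h.transmission_lt hn hin).le) hX
  exact pos_of_mul_pos_right (h3.trans_lt h2)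
    (sub_nonneg.2 (h.transmission_lt hn (i := i) (by omega)).le)

theorem two_lt_one (h : IsTopBroomVector n ρ X) (hn : 5 ≤ n) (h1 : 0 < X 1) : X 2 < X 1 := by
  have h2 := h.step_two hn (k := 1) (by omega)
  have h3 := broomTransmission_sub_two (n := n) (k := 1) (by omega) (by omega)
  have h4 := h.transmission_lt hn (i := 2) (by omega)
  have h5 : (5 : ℝ) ≤ n := by exact_mod_cast hn
  by_contra! h6
  nlinarith

/-- While entries are positive they decrease, so `X i` is at most the mean of the first `i + 1`
entries. This bound on the cut sum outweighs the change `n - 2 (i + 1)` of transmission in `step`.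
-/
theorem succ_lt_of_pos (h : IsTopBroomVector n ρ X) (hn : 5 ≤ n) (h1 : 0 < X 1) {i : ℕ}
    (hi : 2 ≤ i) (hin : i + 1 < n) (hX : 0 < X i) : X (i + 1) < X i := by
  have key : ∀ i, 2 ≤ i → i + 1 < n → 0 < X i →
      (i + 1) * X i ≤ ∑ j ∈ range (i + 1), X j ∧ X (i + 1) < X i := by
    intro i hi
    have hlt : ∀ i, 2 ≤ i → i + 1 < n → 0 < X i →
        (i + 1) * X i ≤ ∑ j ∈ range (i + 1), X j → X (i + 1) < X i := by
      intro i hi hin hX hS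
      have h2 := h.step hn hi hin
      have h3 := broomTransmission_sub_succ hi hin
      have h4 := h.transmission_lt hn hin
      have h5 : (5 : ℝ) ≤ n := by exact_mod_cast hn
      by_contra! h6
      nlinarith
    induction i, hi using Nat.le_induction with
    | base =>
      intro hin hX
      have h2 := h.two_lt_one hn h1
      have h3 : ((2 : ℕ) + 1) * X 2 ≤ ∑ j ∈ range (2 + 1), X j := by
        simp only [sum_range_succ, range_zero, sum_empty, h.zero_eq_one hn]
        push_cast; linarith
      exact ⟨h3, hlt 2 le_rfl hin hX h3⟩
    | succ i hi ih =>
      intro hin hX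
      obtain ⟨h2, h3⟩ := ih (by omega) (h.pos_of_succ_nonneg hn h1 hi (by omega) hX.le)
      have h4 : (((i + 1 : ℕ) : ℝ) + 1) * X (i + 1) ≤ ∑ j ∈ range (i + 1 + 1), X j := by
        rw [sum_range_succ]
        push_cast
        have : (0 : ℝ) ≤ i := Nat.cast_nonneg _
        nlinarith
      exact ⟨h4, hlt _ (by omega) hin hX h4⟩
  exact (key i hi hin hX).2

/-- Mirror image of the positive case: since the total is zero, the cut sum is minus the tail sum,
and the induction runs back from the last vertex. -/
theorem succ_lt_of_neg (h : IsTopBroomVector n ρ X) (hn : 5 ≤ n) (h1 : 0 < X 1) {i : ℕ}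
    (hi : 2 ≤ i) (hin : i + 1 < n) (hX : X (i + 1) < 0) : X (i + 1) < X i := by
  have hlt : ∀ i, 2 ≤ i → i + 1 < n → X (i + 1) < 0 →
      -((n - i - 1) * X (i + 1)) ≤ ∑ j ∈ range (i + 1), X j → X (i + 1) < X i := by
    intro i hi hin hX hS
    have h2 := h.step hn hi hin
    have h3 := broomTransmission_sub_succ hi hin
    have h4 := h.transmission_lt hn (i := i) (by omega)
    have h5 : (5 : ℝ) ≤ n := by exact_mod_cast hn
    by_contra! h6
    nlinarith
  have key : ∀ k i, i + 1 + k + 1 = n → 2 ≤ i → X (i + 1) < 0 →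
      -((n - i - 1) * X (i + 1)) ≤ ∑ j ∈ range (i + 1), X j ∧ X (i + 1) < X i := by
    intro k
    induction k with
    | zero =>
      intro i hk hi hX
      have h0 := h.sum_eq_zero hn
      have h2 : -((n - i - 1) * X (i + 1)) ≤ ∑ j ∈ range (i + 1), X j := by
        rw [← hk, sum_range_succ] at h0
        rw [← hk]
        push_cast
        linarith
      exact ⟨h2, hlt i hi (by omega) hX h2⟩
    | succ k ih =>
      intro i hk hi hX
      have hX' : X (i + 1 + 1) < 0 := by
        by_contra! h2
        have := h.pos_of_succ_nonneg hn h1 (i := i + 1) (by omega) (by omega) h2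
        linarith
      obtain ⟨h2, h3⟩ := ih (i + 1) (by omega) (by omega) hX'
      have h4 : -((n - i - 1) * X (i + 1)) ≤ ∑ j ∈ range (i + 1), X j := by
        rw [sum_range_succ] at h2
        push_cast at h2
        have : (i : ℝ) + 2 ≤ n := by exact_mod_cast (by omega : i + 2 ≤ n)
        nlinarith
      exact ⟨h4, hlt i hi (by omega) hX h4⟩
  exact (key (n - (i + 1) - 1) i (by omega) hi hX).2

/-- A top eigenvector of the broom, positive at the twin leaves, decreases along the path. -/
theorem succ_lt (h : IsTopBroomVector n ρ X) (hn : 5 ≤ n) (h1 : 0 < X 1) {i : ℕ}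
    (hi : 1 ≤ i) (hin : i + 1 < n) : X (i + 1) < X i := by
  rcases hi.eq_or_lt with rfl | hi
  · exact h.two_lt_one hn h1
  · rcases lt_or_ge (X (i + 1)) 0 with h2 | h2
    · exact h.succ_lt_of_neg hn h1 hi hin h2
    · exact h.succ_lt_of_pos hn h1 hi hin (h.pos_of_succ_nonneg hn h1 hi hin h2)

theorem lt_of_lt (h : IsTopBroomVector n ρ X) (hn : 5 ≤ n) (h1 : 0 < X 1) {i j : ℕ}
    (hij : i < j) (hj2 : 2 ≤ j) (hj : j < n) : X j < X i := by
  have key : ∀ i, 1 ≤ i → ∀ j, i + 1 ≤ j → j < n → X j < X i := by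
    intro i hi j hij
    induction j, hij using Nat.le_induction with
    | base => exact fun hj => h.succ_lt hn h1 hi hj
    | succ j hij ih => exact fun hj => (h.succ_lt hn h1 (by omega) hj).trans (ih (by omega))
  rcases Nat.eq_zero_or_pos i with rfl | hi
  · rw [h.zero_eq_one hn]
    exact key 1 le_rfl j hj2 hj
  · exact key i hi j hij hj

end IsTopBroomVector

end BroomSpectrum

/-! ### The largest eigenvalue and the Laplacian form -/

section TopEigenvalue

open Matrix

variable {V : Type*} [Fintype V] [DecidableEq V]

theorem Matrix.IsHermitian.posSemidef_sSup_spectrum_sub {A : Matrix V V ℝ} (hA : A.IsHermitian) :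
    (algebraMap ℝ (Matrix V V ℝ) (sSup (spectrum ℝ A)) - A).PosSemidef := by
  rw [posSemidef_iff_isHermitian_and_spectrum_nonneg]
  refine ⟨?_, ?_⟩
  · refine IsHermitian.sub ?_ hA
    rw [Algebra.algebraMap_eq_smul_one]
    exact isHermitian_one.smul (star_trivial _)
  · rw [← spectrum.singleton_sub_eq]
    rintro _ ⟨_, rfl, a, ha, rfl⟩
    exact sub_nonneg.2 (le_csSup finite_real_spectrum.bddAbove ha)

theorem Matrix.IsHermitian.exists_eigenvector_sSup_spectrum [Nonempty V] {A : Matrix V V ℝ}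
    (hA : A.IsHermitian) : ∃ x : V → ℝ, x ≠ 0 ∧ A *ᵥ x = sSup (spectrum ℝ A) • x := by
  have hmem : sSup (spectrum ℝ A) ∈ spectrum ℝ A := by
    refine Set.Nonempty.csSup_mem ?_ finite_real_spectrum
    rw [hA.spectrum_real_eq_range_eigenvalues]
    exact Set.range_nonempty _
  obtain ⟨j, hj⟩ := hA.spectrum_real_eq_range_eigenvalues ▸ hmem
  refine ⟨⇑(hA.eigenvectorBasis j), fun h => ?_, ?_⟩
  · exact hA.eigenvectorBasis.orthonormal.ne_zero j (by ext i; exact congrFun h i)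
  · rw [hA.mulVec_eigenvectorBasis, hj, hA.spectrum_real_eq_range_eigenvalues]

namespace SimpleGraph

theorem distanceLaplacian_isHermitian (G : SimpleGraph V) : G.distanceLaplacian.IsHermitian := by
  refine IsHermitian.sub (isHermitian_diagonal _) ?_
  ext u v
  simp [distanceMatrix, dist_comm]

theorem distanceLaplacian_mulVec (G : SimpleGraph V) (x : V → ℝ) (u : V) :
    (G.distanceLaplacian *ᵥ x) u = G.transmission u * x u - ∑ v, (G.dist u v : ℝ) * x v := by
  rw [distanceLaplacian, sub_mulVec, Pi.sub_apply, mulVec_diagonal]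
  rfl

theorem dotProduct_distanceLaplacian (G : SimpleGraph V) (x : V → ℝ) :
    x ⬝ᵥ (G.distanceLaplacian *ᵥ x) =
      1 / 2 * ∑ u, ∑ v, (G.dist u v : ℝ) * (x u - x v) ^ 2 := by
  have h1 : ∑ u, ∑ v, (G.dist u v : ℝ) * x v ^ 2 = ∑ u, ∑ v, (G.dist u v : ℝ) * x u ^ 2 := by
    rw [Finset.sum_comm]
    simp only [dist_comm]
  have h2 : x ⬝ᵥ (G.distanceLaplacian *ᵥ x) =
      ∑ u, ∑ v, (G.dist u v : ℝ) * x u ^ 2 - ∑ u, ∑ v, (G.dist u v : ℝ) * (x u * x v) := by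
    rw [← Finset.sum_sub_distrib]
    refine Finset.sum_congr rfl fun u _ => ?_
    rw [distanceLaplacian_mulVec, transmission, mul_sub, Finset.sum_mul, Finset.mul_sum,
      Finset.mul_sum]
    congr 1 <;> exact Finset.sum_congr rfl fun v _ => by ring
  have h3 : ∑ u, ∑ v, (G.dist u v : ℝ) * (x u - x v) ^ 2 =
      ∑ u, ∑ v, (G.dist u v : ℝ) * x u ^ 2 + ∑ u, ∑ v, (G.dist u v : ℝ) * x v ^ 2
        - 2 * ∑ u, ∑ v, (G.dist u v : ℝ) * (x u * x v) := by
    simp only [Finset.mul_sum, ← Finset.sum_sub_distrib, ← Finset.sum_add_distrib]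
    exact Finset.sum_congr rfl fun u _ => Finset.sum_congr rfl fun v _ => by ring
  rw [h3, h1, h2]
  ring

theorem dotProduct_distanceLaplacian_le (G : SimpleGraph V) (x : V → ℝ) :
    x ⬝ᵥ (G.distanceLaplacian *ᵥ x) ≤ G.distanceLaplacianSpectralRadius * (x ⬝ᵥ x) := by
  have := G.distanceLaplacian_isHermitian.posSemidef_sSup_spectrum_sub.dotProduct_mulVec_nonneg x
  rw [Algebra.algebraMap_eq_smul_one, sub_mulVec, smul_mulVec, one_mulVec, dotProduct_sub,
    dotProduct_smul, star_trivial, smul_eq_mul] at this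
  exact sub_nonneg.1 this

/-- A vector on which a positive semidefinite form vanishes lies in the kernel of its matrix. -/
theorem distanceLaplacian_mulVec_of_eq (G : SimpleGraph V) {x : V → ℝ}
    (h : x ⬝ᵥ (G.distanceLaplacian *ᵥ x) = G.distanceLaplacianSpectralRadius * (x ⬝ᵥ x)) :
    G.distanceLaplacian *ᵥ x = G.distanceLaplacianSpectralRadius • x := by
  have := (G.distanceLaplacian_isHermitian.posSemidef_sSup_spectrum_sub.dotProduct_mulVec_zero_iff
    x).1
  rw [Algebra.algebraMap_eq_smul_one, sub_mulVec, smul_mulVec, one_mulVec, dotProduct_sub,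
    dotProduct_smul, star_trivial, smul_eq_mul] at this
  exact (sub_eq_zero.1 (this (sub_eq_zero.2 h.symm))).symm

end SimpleGraph

end TopEigenvalue

/-! ### The broom as a graph -/

section BroomGraph

/-- The neighbour of `i` towards `j`; iterating it gives walks of length `broomDist`, all with
labels below `n`. -/
theorem exists_broomDist_eq_succ {n i j : ℕ} (hn : 3 ≤ n) (hi : i < n) (hj : j < n) (hij : i ≠ j) :
    ∃ k < n, broomDist i k = 1 ∧ broomDist i j = broomDist k j + 1 := by
  by_cases h2 : i < 2
  · exact ⟨2, by omega, by unfold broomDist; grind, by unfold broomDist; grind⟩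
  by_cases hj0 : j = 0 ∧ i = 2
  · exact ⟨0, by omega, by unfold broomDist; grind, by unfold broomDist; grind⟩
  by_cases hlt : i < j
  · exact ⟨i + 1, by omega, by unfold broomDist; grind, by unfold broomDist; grind⟩
  · exact ⟨i - 1, by omega, by unfold broomDist; grind, by unfold broomDist; grind⟩

theorem broomDist_le_of_eq_one {i k : ℕ} (h : broomDist i k = 1) (j : ℕ) :
    broomDist i j ≤ 1 + broomDist k j := by
  unfold broomDist at *; grind

theorem eq_of_broomDist_eq_zero {i j : ℕ} (h : broomDist i j = 0) : i = j := by
  unfold broomDist at h; grind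

variable {V : Type*}

/-- The graph in which two vertices are adjacent if their labels are neighbours in the broom. -/
def broomGraph (σ : V → ℕ) : SimpleGraph V where
  Adj u v := broomDist (σ u) (σ v) = 1
  symm := ⟨fun u v h => by rwa [broomDist_comm]⟩
  loopless := ⟨fun u h => by simp [broomDist_self] at h⟩

theorem broomGraph_adj {σ : V → ℕ} {u v : V} :
    (broomGraph σ).Adj u v ↔ broomDist (σ u) (σ v) = 1 := Iff.rfl

theorem broomDist_le_walk_length {σ : V → ℕ} {u v : V} (p : (broomGraph σ).Walk u v) :
    broomDist (σ u) (σ v) ≤ p.length := by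
  induction p with
  | nil => simp [broomDist_self]
  | cons h p ih =>
    have := broomDist_le_of_eq_one (broomGraph_adj.1 h)
    rw [SimpleGraph.Walk.length_cons]
    exact (this _).trans (by omega)

variable [Fintype V] {σ : V → ℕ}

theorem IsLabelling.lt (h : IsLabelling Finset.univ σ) (u : V) : σ u < Fintype.card V :=
  h.2 u (Finset.mem_univ u)

theorem IsLabelling.injective (h : IsLabelling Finset.univ σ) : Function.Injective σ :=
  fun u v huv => h.1 (by simp) (by simp) huv

theorem IsLabelling.exists_label (h : IsLabelling Finset.univ σ) {i : ℕ}
    (hi : i < Fintype.card V) : ∃ u, σ u = i := by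
  obtain ⟨u, -, hu⟩ := h.exists_eq (i := i) (by simpa using hi)
  exact ⟨u, hu⟩

theorem IsLabelling.sum_eq (h : IsLabelling Finset.univ σ) (f : ℕ → ℝ) :
    ∑ u, f (σ u) = ∑ i ∈ Finset.range (Fintype.card V), f i :=
  Finset.sum_bij (fun u _ => σ u) (fun u _ => Finset.mem_range.2 (h.lt u))
    (fun _ _ _ _ huv => h.injective huv)
    (fun i hi => by
      obtain ⟨u, hu⟩ := h.exists_label (Finset.mem_range.1 hi)
      exact ⟨u, Finset.mem_univ u, hu⟩) (fun _ _ => rfl)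

theorem IsLabelling.exists_walk (h : IsLabelling Finset.univ σ) (hV : 3 ≤ Fintype.card V)
    (u v : V) : ∃ p : (broomGraph σ).Walk u v, p.length = broomDist (σ u) (σ v) := by
  induction hk : broomDist (σ u) (σ v) generalizing u with
  | zero =>
    obtain rfl := h.injective (eq_of_broomDist_eq_zero hk)
    exact ⟨.nil, rfl⟩
  | succ k ih =>
    have huv : σ u ≠ σ v := fun e => by simp [e, broomDist_self] at hk
    obtain ⟨i, hi, h1, h2⟩ := exists_broomDist_eq_succ hV (h.lt u) (h.lt v) huv
    obtain ⟨w, rfl⟩ := h.exists_label hi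
    obtain ⟨p, hp⟩ := ih w (by omega)
    exact ⟨.cons (broomGraph_adj.2 h1) p, by rw [SimpleGraph.Walk.length_cons, hp]⟩

theorem IsLabelling.broomGraph_dist (h : IsLabelling Finset.univ σ) (hV : 3 ≤ Fintype.card V)
    (u v : V) : (broomGraph σ).dist u v = broomDist (σ u) (σ v) := by
  obtain ⟨p, hp⟩ := h.exists_walk hV u v
  obtain ⟨q, hq⟩ := SimpleGraph.Reachable.exists_walk_length_eq_dist ⟨p⟩
  refine le_antisymm (hp ▸ SimpleGraph.dist_le p) ?_
  rw [← hq]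
  exact broomDist_le_walk_length q

theorem IsLabelling.broomGraph_connected (h : IsLabelling Finset.univ σ)
    (hV : 3 ≤ Fintype.card V) : (broomGraph σ).Connected where
  preconnected u v := ⟨(h.exists_walk hV u v).choose⟩
  nonempty := Fintype.card_pos_iff.1 (by omega)

omit [Fintype V] in
theorem SimpleGraph.not_isPendantVertex {G : SimpleGraph V} {u v w : V} (hv : G.Adj u v)
    (hw : G.Adj u w) (hvw : v ≠ w) : ¬ G.IsPendantVertex u := by
  intro h
  obtain ⟨a, ha⟩ := Set.ncard_eq_one.1 h
  have h1 : v ∈ G.neighborSet u := hv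
  have h2 : w ∈ G.neighborSet u := hw
  rw [ha, Set.mem_singleton_iff] at h1 h2
  exact hvw (h1.trans h2.symm)

omit [Fintype V] in
theorem SimpleGraph.isPendantVertex_of_unique {G : SimpleGraph V} {u v : V} (hv : G.Adj u v)
    (h : ∀ w, G.Adj u w → w = v) : G.IsPendantVertex u :=
  Set.ncard_eq_one.2 ⟨v, Set.ext fun w => ⟨h w, fun e => by rw [Set.mem_singleton_iff.1 e]; exact hv⟩⟩

theorem IsLabelling.broomGraph_isPendantVertex (h : IsLabelling Finset.univ σ)
    (hV : 4 ≤ Fintype.card V) (u : V) :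
    (broomGraph σ).IsPendantVertex u ↔ σ u = 0 ∨ σ u = 1 ∨ σ u + 1 = Fintype.card V := by
  have hu := h.lt u
  refine ⟨fun hp => ?_, fun hp => ?_⟩
  · by_contra! hne
    obtain ⟨v, hv⟩ := h.exists_label (i := σ u - 1) (by omega)
    obtain ⟨w, hw⟩ := h.exists_label (i := σ u + 1) (by omega)
    refine SimpleGraph.not_isPendantVertex (v := v) (w := w) ?_ ?_ ?_ hp
    · rw [broomGraph_adj, hv]; unfold broomDist; grind
    · rw [broomGraph_adj, hw]; unfold broomDist; grind
    · rintro rfl; omega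
  · obtain ⟨v, hv⟩ := h.exists_label (i := if σ u < 2 then 2 else σ u - 1) (by split_ifs <;> omega)
    refine SimpleGraph.isPendantVertex_of_unique (v := v) ?_ fun w hw => h.injective ?_
    · rw [broomGraph_adj, hv]; unfold broomDist; grind
    · have := h.lt w
      rw [broomGraph_adj] at hw
      rw [hv]
      unfold broomDist at hw
      grind

theorem IsLabelling.broomGraph_mem (h : IsLabelling Finset.univ σ) (hV : 4 ≤ Fintype.card V) :
    broomGraph σ ∈ SimpleGraph.connectedWithPendant V 3 := by
  refine ⟨h.broomGraph_connected (by omega), Set.ncard_eq_three.2 ?_⟩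
  obtain ⟨a, ha⟩ := h.exists_label (i := 0) (by omega)
  obtain ⟨b, hb⟩ := h.exists_label (i := 1) (by omega)
  obtain ⟨c, hc⟩ := h.exists_label (i := Fintype.card V - 1) (by omega)
  refine ⟨a, b, c, by rintro rfl; omega, by rintro rfl; omega, by rintro rfl; omega, ?_⟩
  ext u
  simp only [Set.mem_ofPred_eq, h.broomGraph_isPendantVertex hV, Set.mem_insert_iff,
    Set.mem_singleton_iff, ← h.injective.eq_iff, ha, hb, hc]
  omega

open Matrix in
theorem IsLabelling.distanceLaplacian_mulVec [DecidableEq V] (h : IsLabelling Finset.univ σ)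
    (hV : 3 ≤ Fintype.card V) (Z : ℕ → ℝ) (u : V) :
    ((broomGraph σ).distanceLaplacian *ᵥ fun v => Z (σ v)) u =
      broomLaplacian (Fintype.card V) Z (σ u) := by
  rw [SimpleGraph.distanceLaplacian_mulVec, SimpleGraph.transmission]
  simp only [h.broomGraph_dist hV]
  rw [h.sum_eq fun i => (broomDist (σ u) i : ℝ), h.sum_eq fun i => (broomDist (σ u) i : ℝ) * Z i]
  rfl

open Matrix in
theorem IsLabelling.isTopBroomVector [DecidableEq V] (h : IsLabelling Finset.univ σ)
    (hV : 3 ≤ Fintype.card V) {X : ℕ → ℝ}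
    (hX : (broomGraph σ).distanceLaplacian *ᵥ (fun v => X (σ v)) =
      (broomGraph σ).distanceLaplacianSpectralRadius • fun v => X (σ v)) :
    IsTopBroomVector (Fintype.card V) (broomGraph σ).distanceLaplacianSpectralRadius X := by
  have hform : ∀ Z : ℕ → ℝ, (fun v => Z (σ v)) ⬝ᵥ
      ((broomGraph σ).distanceLaplacian *ᵥ fun v => Z (σ v)) =
      ∑ i ∈ Finset.range (Fintype.card V), broomLaplacian (Fintype.card V) Z i * Z i := by
    intro Z
    rw [← h.sum_eq fun i => broomLaplacian (Fintype.card V) Z i * Z i]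
    exact Finset.sum_congr rfl fun u _ => by rw [h.distanceLaplacian_mulVec hV, mul_comm]
  have hsq : ∀ Z : ℕ → ℝ, (fun v => Z (σ v)) ⬝ᵥ (fun v => Z (σ v)) =
      ∑ i ∈ Finset.range (Fintype.card V), Z i ^ 2 := by
    intro Z
    rw [← h.sum_eq fun i => Z i ^ 2]
    exact Finset.sum_congr rfl fun u _ => (sq _).symm
  have heig : ∀ Z : ℕ → ℝ, (broomGraph σ).distanceLaplacian *ᵥ (fun v => Z (σ v)) =
      (broomGraph σ).distanceLaplacianSpectralRadius • (fun v => Z (σ v)) →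
      ∀ i < Fintype.card V, broomLaplacian (Fintype.card V) Z i =
        (broomGraph σ).distanceLaplacianSpectralRadius * Z i := by
    intro Z hZ i hi
    obtain ⟨u, rfl⟩ := h.exists_label hi
    rw [← h.distanceLaplacian_mulVec hV, hZ]
    rfl
  refine ⟨heig X hX, fun Z => ?_, fun Z hZ => heig Z ?_⟩
  · rw [← hform, ← hsq]
    exact SimpleGraph.dotProduct_distanceLaplacian_le _ _
  · rw [← hform, ← hsq] at hZ
    exact SimpleGraph.distanceLaplacian_mulVec_of_eq _ hZ

/-- A graph whose adjacency is that of a labelled broom is isomorphic to `T(n, 3; 1, 2)`. -/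
theorem IsLabelling.nonempty_iso (h : IsLabelling Finset.univ σ) {n : ℕ}
    (hn : 5 ≤ n) (hV : Fintype.card V = n) {G : SimpleGraph V}
    (hG : ∀ u v, G.Adj u v ↔ broomDist (σ u) (σ v) = 1) :
    Nonempty (G ≃g SimpleGraph.pathWithPendants n 3 1 2) := by
  subst hV
  set n := Fintype.card V with hndef
  -- The path is labelled backwards, since its last vertex carries the two twins and must receive
  -- label `2`.
  set l : Fin (n - 3) ⊕ (Fin 1 ⊕ Fin 2) → ℕ :=
    Sum.elim (fun i => n - 2 - i) (Sum.elim (fun _ => n - 1) (fun k => k)) with hl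
  have hlt : ∀ x, l x < n := by
    rintro (i | i | i) <;> simp only [hl, Sum.elim_inl, Sum.elim_inr] <;> omega
  have hinj : Function.Injective l := by
    rintro (i | i | i) (j | j | j) hij <;> simp only [hl, Sum.elim_inl, Sum.elim_inr] at hij
    · congr 1; ext; omega
    · omega
    · omega
    · omega
    · congr 2; ext; omega
    · omega
    · omega
    · omega
    · congr 2; ext; omega
  choose f hf using fun x => h.exists_label (hlt x)
  have hfinj : Function.Injective f := fun x y hxy => hinj (by rw [← hf, ← hf, hxy])
  have hfbij : Function.Bijective f := by
    rw [Fintype.bijective_iff_injective_and_card]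
    refine ⟨hfinj, ?_⟩
    simp only [Fintype.card_sum, Fintype.card_fin]
    omega
  refine ⟨RelIso.symm ⟨Equiv.ofBijective f hfbij, ?_⟩⟩
  intro x y
  rw [Equiv.ofBijective_apply, Equiv.ofBijective_apply, hG, hf, hf, SimpleGraph.pathWithPendants,
    SimpleGraph.fromRel_adj]
  rcases x with i | i | i <;> rcases y with j | j | j <;>
    simp only [hl, Sum.elim_inl, Sum.elim_inr, ne_eq, Sum.inl.injEq, Sum.inr.injEq, reduceCtorEq,
      not_false_eq_true, true_and, or_false, false_or, and_false, iff_false, Fin.ext_iff, or_self] <;>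
    unfold broomDist <;> grind

end BroomGraph

/-! ### Rigidity and the extremal graph -/

section Extremal

open Matrix

theorem IsTopBroomVector.eq_iff {n : ℕ} {ρ : ℝ} {X : ℕ → ℝ} (h : IsTopBroomVector n ρ X)
    (hn : 5 ≤ n) (h1 : X 1 ≠ 0) {i j : ℕ} (hi : i < n) (hj : j < n) :
    X i = X j ↔ i = j ∨ i < 2 ∧ j < 2 := by
  have hlt : ∀ i j, i < j → 2 ≤ j → j < n → X i ≠ X j := by
    intro i j hij hj2 hj
    rcases lt_or_gt_of_ne h1 with h1 | h1
    · have := h.neg.lt_of_lt hn (by simpa using h1) hij hj2 hj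
      exact fun e => by simp [e] at this
    · exact (h.lt_of_lt hn h1 hij hj2 hj).ne'
  constructor
  · intro hX
    by_contra! hne
    rcases lt_or_gt_of_ne hne.1 with hij | hij
    · exact hlt i j hij (by omega) hj hX
    · exact hlt j i hij (by omega) hi hX.symm
  · rintro (rfl | ⟨hi2, hj2⟩)
    · rfl
    · have := h.zero_eq_one hn
      interval_cases i <;> interval_cases j <;> simp [this]

variable {V : Type*} [Fintype V]

/-- The tree metric is determined by a top eigenvector. -/
theorem labelDist_eq_of_isTopBroomVector {σ τ : V → ℕ} {n : ℕ} {ρ : ℝ} {X Y : ℕ → ℝ} (hn : 5 ≤ n)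
    (hV : Fintype.card V = n) (hσ : IsLabelling Finset.univ σ) (hτ : IsLabelling Finset.univ τ)
    (hX : IsTopBroomVector n ρ X) (hY : IsTopBroomVector n ρ Y) (hX1 : X 1 ≠ 0) (hY1 : Y 1 ≠ 0)
    (hXY : ∀ u, X (σ u) = Y (τ u)) : labelDist σ = labelDist τ := by
  subst hV
  obtain ⟨a, ha⟩ := hσ.exists_label (i := 0) (by omega)
  obtain ⟨b, hb⟩ := hσ.exists_label (i := 1) (by omega)
  have hab : Y (τ a) = Y (τ b) := by
    rw [← hXY, ← hXY, ha, hb]; exact hX.zero_eq_one hn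
  have hτb : τ b < 2 := by
    rcases (hY.eq_iff hn hY1 (hτ.lt a) (hτ.lt b)).1 hab with h | h
    · have := hτ.injective h
      subst this; omega
    · exact h.2
  -- The twins of `σ` are twins of `τ`, as only twins share a value; this fixes the common scale, so
  -- `X` and `Y` agree on all labels.
  have h1 : X 1 = Y 1 := by
    rw [← hb, hXY]
    exact (hY.eq_iff hn hY1 (hτ.lt b) (by omega)).2 (Or.inr ⟨hτb, by omega⟩)
  have key : ∀ u, σ u = τ u ∨ σ u < 2 ∧ τ u < 2 := by
    intro u
    refine (hX.eq_iff hn hX1 (hσ.lt u) (hτ.lt u)).1 ?_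
    rw [hXY u, hX.eq_of_one_eq hY hn h1 (hτ.lt u)]
  funext u v
  have hinj : σ u = σ v ↔ τ u = τ v := by rw [hσ.injective.eq_iff, hτ.injective.eq_iff]
  have hu := key u
  have hv := key v
  unfold labelDist
  congr 1
  unfold broomDist
  grind

/-- If all degrees were at most 2, three leaves would give `2|E| + 3 ≤ 2|V|`, against `|E| ≥ |V| -
1`. -/
theorem SimpleGraph.exists_three_neighbors {G : SimpleGraph V}
    (hG : G ∈ SimpleGraph.connectedWithPendant V 3) :
    ∃ c a₁ a₂ a₃, G.Adj c a₁ ∧ G.Adj c a₂ ∧ G.Adj c a₃ ∧ a₁ ≠ a₂ ∧ a₁ ≠ a₃ ∧ a₂ ≠ a₃ := by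
  classical
  obtain ⟨hconn, hp⟩ := hG
  suffices ∃ c, 2 < G.degree c by
    obtain ⟨c, hc⟩ := this
    obtain ⟨a₁, a₂, a₃, h₁, h₂, h₃, h⟩ := Finset.two_lt_card_iff.1 hc
    simp only [mem_neighborFinset] at h₁ h₂ h₃
    exact ⟨c, a₁, a₂, a₃, h₁, h₂, h₃, h⟩
  by_contra! hdeg
  have hpend : ∀ u, G.IsPendantVertex u → G.degree u = 1 := by
    intro u hu
    rw [← G.card_neighborSet_eq_degree u, ← Set.toFinset_card, ← Set.ncard_eq_toFinset_card']
    exact hu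
  have h1 := hconn.card_vert_le_card_edgeSet_add_one
  rw [Nat.card_eq_fintype_card, Nat.card_eq_fintype_card, ← edgeFinset_card] at h1
  have h2 := G.sum_degrees_eq_twice_card_edges
  have h3 : ∑ u, (G.degree u + if G.IsPendantVertex u then 1 else 0) ≤ ∑ _u : V, 2 := by
    refine Finset.sum_le_sum fun u _ => ?_
    split_ifs with hu
    · rw [hpend u hu]
    · exact hdeg u
  rw [Finset.sum_add_distrib, Finset.sum_boole, h2] at h3
  have h4 : (Finset.univ.filter fun u => G.IsPendantVertex u).card = 3 := by
    rw [← hp, Set.ncard_eq_toFinset_card']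
    congr 1
    ext u
    simp
  rw [h4] at h3
  simp at h3
  omega

/-- In a convex combination that attains the maximum of a linear form over the points, only
maximisers occur. -/
theorem eq_of_mem_convexHull_of_le {E : Type*} [AddCommGroup E] [Module ℝ E] {A : Set E} {e : E}
    (he : e ∈ convexHull ℝ A) (f : E →ₗ[ℝ] ℝ) {M : ℝ} (hA : ∀ a ∈ A, f a ≤ M) (hM : M ≤ f e)
    (huniq : ∀ a ∈ A, ∀ b ∈ A, f a = M → f b = M → a = b) : e ∈ A ∧ f e = M := by
  obtain ⟨ι, _, w, z, hw, hw1, hz, rfl⟩ := mem_convexHull_iff_exists_fintype.1 he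
  have hsum : f (∑ i, w i • z i) = ∑ i, w i * f (z i) := by
    rw [map_sum]; simp
  have hzero : ∑ i, w i * (M - f (z i)) = 0 := by
    refine le_antisymm ?_ (Finset.sum_nonneg fun i _ =>
      mul_nonneg (hw i) (sub_nonneg.2 (hA _ (hz i))))
    simp only [mul_sub, Finset.sum_sub_distrib, ← Finset.sum_mul, hw1]
    linarith
  have hterm : ∀ i, w i ≠ 0 → f (z i) = M := by
    intro i hi
    have := (Finset.sum_eq_zero_iff_of_nonneg fun i _ =>
      mul_nonneg (hw i) (sub_nonneg.2 (hA _ (hz i)))).1 hzero i (Finset.mem_univ i)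
    rcases mul_eq_zero.1 this with h | h
    · exact absurd h hi
    · linarith
  obtain ⟨i₀, -, hi₀⟩ : ∃ i ∈ Finset.univ, w i ≠ 0 :=
    Finset.exists_ne_zero_of_sum_ne_zero (by rw [hw1]; exact one_ne_zero)
  have heq : ∑ i, w i • z i = z i₀ := by
    have : ∀ i ∈ Finset.univ, w i • z i = w i • z i₀ := by
      intro i _
      by_cases hi : w i = 0
      · simp [hi]
      · rw [huniq _ (hz i) _ (hz i₀) (hterm i hi) (hterm i₀ hi₀)]
    rw [Finset.sum_congr rfl this, ← Finset.sum_smul, hw1, one_smul]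
  rw [heq]
  exact ⟨hz i₀, hterm i₀ hi₀⟩

/-- The Laplacian form of a weight function, as a linear form in the weights. -/
noncomputable def laplacianForm (x : V → ℝ) : (V → V → ℝ) →ₗ[ℝ] ℝ where
  toFun d := 1 / 2 * ∑ u, ∑ v, d u v * (x u - x v) ^ 2
  map_add' d d' := by
    simp only [Pi.add_apply, add_mul, Finset.sum_add_distrib, mul_add]
  map_smul' c d := by
    simp only [Pi.smul_apply, smul_eq_mul, mul_assoc, ← Finset.mul_sum, RingHom.id_apply]
    ring

theorem laplacianForm_apply (x : V → ℝ) (d : V → V → ℝ) :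
    laplacianForm x d = 1 / 2 * ∑ u, ∑ v, d u v * (x u - x v) ^ 2 := rfl

theorem laplacianForm_mono (x : V → ℝ) {d e : V → V → ℝ} (h : ∀ u v, d u v ≤ e u v) :
    laplacianForm x d ≤ laplacianForm x e := by
  simp only [laplacianForm_apply]
  gcongr with u _ v _
  exact h u v

theorem eq_of_laplacianForm_le (x : V → ℝ) {d e : V → V → ℝ} (h : ∀ u v, d u v ≤ e u v)
    (hle : laplacianForm x e ≤ laplacianForm x d) {u v : V} (huv : x u ≠ x v) :
    d u v = e u v := by
  have hnonneg : ∀ u v, 0 ≤ (e u v - d u v) * (x u - x v) ^ 2 := fun u v =>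
    mul_nonneg (sub_nonneg.2 (h u v)) (sq_nonneg _)
  have hzero : ∑ u, ∑ v, (e u v - d u v) * (x u - x v) ^ 2 = 0 := by
    refine le_antisymm ?_ (Finset.sum_nonneg fun u _ => Finset.sum_nonneg fun v _ => hnonneg u v)
    simp only [laplacianForm_apply] at hle
    simp only [sub_mul, Finset.sum_sub_distrib]
    linarith
  have h1 := (Finset.sum_eq_zero_iff_of_nonneg fun u _ =>
    Finset.sum_nonneg fun v _ => hnonneg u v).1 hzero u (Finset.mem_univ u)
  have h2 := (Finset.sum_eq_zero_iff_of_nonneg fun v _ => hnonneg u v).1 h1 v (Finset.mem_univ v)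
  rcases mul_eq_zero.1 h2 with h3 | h3
  · linarith
  · exact absurd (sub_eq_zero.1 (pow_eq_zero_iff two_ne_zero |>.1 h3)) huv

variable [DecidableEq V]

theorem SimpleGraph.laplacianForm_dist (G : SimpleGraph V) (x : V → ℝ) :
    laplacianForm x (fun u v => (G.dist u v : ℝ)) = x ⬝ᵥ (G.distanceLaplacian *ᵥ x) :=
  (G.dotProduct_distanceLaplacian x).symm

theorem IsLabelling.laplacianForm_labelDist {σ : V → ℕ} (h : IsLabelling Finset.univ σ)
    (hV : 3 ≤ Fintype.card V) (x : V → ℝ) :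
    laplacianForm x (labelDist σ) = x ⬝ᵥ ((broomGraph σ).distanceLaplacian *ᵥ x) := by
  rw [← SimpleGraph.laplacianForm_dist]
  simp only [h.broomGraph_dist hV]
  rfl

/-- A vector whose form with respect to a labelled broom is at least `ρ` comes from a top
eigenvector of the broom, when the spectral radius of the broom is at most `ρ`. -/
theorem IsLabelling.exists_isTopBroomVector {σ : V → ℕ} (h : IsLabelling Finset.univ σ)
    (hV : 5 ≤ Fintype.card V) {ρ : ℝ} (hρ : (broomGraph σ).distanceLaplacianSpectralRadius ≤ ρ)
    {x : V → ℝ} (hx : x ≠ 0) (hform : laplacianForm x (labelDist σ) = ρ * (x ⬝ᵥ x)) :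
    ∃ X : ℕ → ℝ, (∀ u, X (σ u) = x u) ∧ IsTopBroomVector (Fintype.card V) ρ X ∧ X 1 ≠ 0 := by
  have hpos : 0 < x ⬝ᵥ x := by
    refine lt_of_le_of_ne (Finset.sum_nonneg fun u _ => mul_self_nonneg _) fun h0 => hx ?_
    exact dotProduct_self_eq_zero.1 h0.symm
  rw [h.laplacianForm_labelDist (by omega)] at hform
  have hle := (broomGraph σ).dotProduct_distanceLaplacian_le x
  rw [hform] at hle
  -- The form at `x` attains `ρ`, so the spectral radius of the broom is exactly `ρ`.
  obtain rfl := le_antisymm hρ (le_of_mul_le_mul_right hle hpos)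
  have : Nonempty V := Fintype.card_pos_iff.1 (by omega)
  have hX : ∀ u, x (Function.invFun σ (σ u)) = x u := fun u =>
    congrArg x (Function.leftInverse_invFun h.injective u)
  have htop := h.isTopBroomVector (by omega) (X := fun i => x (Function.invFun σ i)) (by
    simp only [hX]
    exact (broomGraph σ).distanceLaplacian_mulVec_of_eq hform)
  refine ⟨_, hX, htop, htop.one_ne_zero hV ?_⟩
  obtain ⟨u, hu⟩ := Function.ne_iff.1 hx
  exact ⟨σ u, h.lt u, by rw [hX]; exact hu⟩

omit [DecidableEq V] in
/-- If the distances of `G` agree with those of a labelled broom up to the twin leaves, then `G` is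
the broom, unless it has too few pendant vertices. -/
theorem IsLabelling.adj_iff {σ : V → ℕ} (h : IsLabelling Finset.univ σ) (hV : 5 ≤ Fintype.card V)
    {G : SimpleGraph V} (hG : G ∈ SimpleGraph.connectedWithPendant V 3)
    (hdist : ∀ u v, ¬ (σ u < 2 ∧ σ v < 2) → G.dist u v = broomDist (σ u) (σ v)) (u v : V) :
    G.Adj u v ↔ broomDist (σ u) (σ v) = 1 := by
  by_cases huv : σ u < 2 ∧ σ v < 2
  · have hne : broomDist (σ u) (σ v) ≠ 1 := by unfold broomDist; grind
    refine iff_of_false (fun hadj => ?_) hne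
    have hadj' : ∀ a b, a ≠ b → σ a < 2 → σ b < 2 → G.Adj a b := by
      intro a b hab ha hb
      have := h.injective.ne hab
      have := h.injective.ne hadj.ne
      rcases (by omega : (σ a = σ u ∧ σ b = σ v) ∨ (σ a = σ v ∧ σ b = σ u)) with ⟨h1, h2⟩ | ⟨h1, h2⟩
      · rwa [h.injective h1, h.injective h2]
      · rw [h.injective h1, h.injective h2]; exact hadj.symm
    -- Adjacent twins form a triangle with `2`, and interior path vertices keep two neighbours, so
    -- only the last vertex can be pendant.
    have hpend : ∀ w, G.IsPendantVertex w → σ w + 1 = Fintype.card V := by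
      intro w hw
      by_contra hlast
      have hlt := h.lt w
      by_cases hw2 : σ w < 2
      · obtain ⟨a, ha⟩ := h.exists_label (i := 1 - σ w) (by omega)
        obtain ⟨b, hb⟩ := h.exists_label (i := 2) (by omega)
        refine SimpleGraph.not_isPendantVertex (v := a) (w := b)
          (hadj' w a ?_ hw2 (by omega)) ?_ ?_ hw
        · rintro rfl; omega
        · rw [← SimpleGraph.dist_eq_one_iff_adj, hdist w b (by omega), hb]
          unfold broomDist; grind
        · rintro rfl; omega
      · obtain ⟨a, ha⟩ := h.exists_label (i := σ w - 1) (by omega)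
        obtain ⟨b, hb⟩ := h.exists_label (i := σ w + 1) (by omega)
        refine SimpleGraph.not_isPendantVertex (v := a) (w := b) ?_ ?_ ?_ hw
        · rw [← SimpleGraph.dist_eq_one_iff_adj, hdist w a (by omega), ha]
          unfold broomDist; grind
        · rw [← SimpleGraph.dist_eq_one_iff_adj, hdist w b (by omega), hb]
          unfold broomDist; grind
        · rintro rfl; omega
    obtain ⟨a, b, c, hab, -, -, hS⟩ := Set.ncard_eq_three.1 hG.2
    have ha : a ∈ {v | G.IsPendantVertex v} := by rw [hS]; simp
    have hb : b ∈ {v | G.IsPendantVertex v} := by rw [hS]; simp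
    have ha' := hpend a ha
    have hb' := hpend b hb
    exact hab (h.injective (by omega))
  · rw [← SimpleGraph.dist_eq_one_iff_adj, hdist u v huv]

end Extremal

theorem theorem2p7 {V : Type*} [Fintype V] [DecidableEq V] (n : ℕ) (hn : 5 ≤ n)
    (hV : Fintype.card V = n) (G : SimpleGraph V)
    (hG : G ∈ SimpleGraph.connectedWithPendant V 3)
    (hmax : ∀ H ∈ SimpleGraph.connectedWithPendant V 3,
      H.distanceLaplacianSpectralRadius ≤ G.distanceLaplacianSpectralRadius) :
    Nonempty (G ≃g SimpleGraph.pathWithPendants n 3 1 2) := by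
  subst hV
  have : Nonempty V := Fintype.card_pos_iff.1 (by omega)
  set ρ := G.distanceLaplacianSpectralRadius with hρ
  obtain ⟨c, a₁, a₂, a₃, h₁, h₂, h₃, h₁₂, h₁₃, h₂₃⟩ := SimpleGraph.exists_three_neighbors hG
  obtain ⟨e, he, hGe⟩ := SimpleGraph.dist_mem_broomDominated hG.1 h₁ h₂ h₃ h₁₂ h₁₃ h₂₃
  simp only [Finset.mem_univ, true_imp_iff] at hGe
  obtain ⟨x, hx0, hx⟩ := G.distanceLaplacian_isHermitian.exists_eigenvector_sSup_spectrum
  have hGform : laplacianForm x (fun u v => (G.dist u v : ℝ)) = ρ * (x ⬝ᵥ x) := by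
    rw [G.laplacianForm_dist, hx, dotProduct_smul]
    rfl
  have hσle : ∀ σ : V → ℕ, IsLabelling Finset.univ σ →
      (broomGraph σ).distanceLaplacianSpectralRadius ≤ ρ :=
    fun σ hσ => hmax _ (hσ.broomGraph_mem (by omega))
  have hnonneg : 0 ≤ x ⬝ᵥ x := Finset.sum_nonneg fun u _ => mul_self_nonneg _
  -- Any two maximising brooms have `x` as a top eigenvector, hence the same metric, so the convex
  -- combination collapses to one broom.
  obtain ⟨⟨σ, hσ, rfl⟩, hform⟩ := eq_of_mem_convexHull_of_le he (laplacianForm x)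
    (M := ρ * (x ⬝ᵥ x)) (by
      rintro _ ⟨σ, hσ, rfl⟩
      rw [hσ.laplacianForm_labelDist (by omega)]
      exact ((broomGraph σ).dotProduct_distanceLaplacian_le x).trans
        (mul_le_mul_of_nonneg_right (hσle σ hσ) hnonneg))
    (hGform ▸ laplacianForm_mono x hGe) (by
      rintro _ ⟨σ, hσ, rfl⟩ _ ⟨τ, hτ, rfl⟩ hfσ hfτ
      obtain ⟨X, hXx, hX, hX1⟩ := hσ.exists_isTopBroomVector hn (hσle σ hσ) hx0 hfσ
      obtain ⟨Y, hYx, hY, hY1⟩ := hτ.exists_isTopBroomVector hn (hσle τ hτ) hx0 hfτ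
      exact labelDist_eq_of_isTopBroomVector hn rfl hσ hτ hX hY hX1 hY1
        fun u => (hXx u).trans (hYx u).symm)
  obtain ⟨X, hXx, hX, hX1⟩ := hσ.exists_isTopBroomVector hn (hσle σ hσ) hx0 hform
  refine hσ.nonempty_iso hn rfl (hσ.adj_iff hn hG fun u v huv => ?_)
  rcases eq_or_ne u v with rfl | hne
  · simp [broomDist_self]
  have hxuv : x u ≠ x v := by
    rw [← hXx, ← hXx, Ne, hX.eq_iff hn hX1 (hσ.lt u) (hσ.lt v)]
    rintro (h | h)
    · exact hne (hσ.injective h)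
    · exact huv h
  have := eq_of_laplacianForm_le x hGe (hform.le.trans hGform.ge) hxuv
  exact Nat.cast_injective this
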